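/- Let $n\ge 1$ be an integer, $\nu\ge 0$ and $\sigma$ real with $(2n+1)\sigma^2\ge 6(\nu+1)\log(2n+1)$, and put $\epsilon_r=4(2n+1)^{-(\nu+1)[1+r+r^2(2n+1)]}$ for $r=0,1,2,\dots$. Setting. Consider the Klein–Gordon equation $u_{tt}=u_{xx}-u$ with $2\pi$-periodic boundary conditions as the system $\partial_t(u,\pi)=(\pi,\,u_{xx}-u)$, with energy norm $|(u,\pi)|_A^2=\int_0^{2\pi}(\pi^2+u_x^2+u^2)\,dx$ on $H^1\oplus H^0$. Let $(a_k)_{k\ge0},(b_k)_{k\ge1},(\alpha_k)_{k\ge0},(\beta_k)_{k\ge1}$ be independent centred Gaussian random variables, $a_k,b_k$ with variance $1/(k^2+1)$ and $\alpha_k,\beta_k$ with variance $1$, realized as the coordinates of the infinite product Gaussian measure $P$. For $r\ge 0$ let $m=n+r(2n+1)$, and let $$u^{(m)}=\frac{a_0}{\sqrt{2\pi}}+\sum_{k=1}^m\Big(a_k\frac{\cos kx}{\sqrt\pi}+b_k\frac{\sin kx}{\sqrt\pi}\Big),\qquad \pi^{(m)}=\frac{\alpha_0}{\sqrt{2\pi}}+\sum_{k=1}^m\Big(\alpha_k\frac{\cos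 kx}{\sqrt\pi}+\beta_k\frac{\sin kx}{\sqrt\pi}\Big).$$ Let $g(x)=\frac1{2\pi}\sum_{k\in\mathbb Z}e^{-k^2\sigma^2/4}e^{ikx}$ and $x_\alpha=2\pi\alpha/(2n+1)$, $\alpha=0,\dots,2n$. The $r$-th exact mean $\psi_r(\cdot,t)\in H^1\oplus H^0$ is the average at time $t$ of all solutions $(u,\pi)$ of the system that are pairs of real trigonometric polynomials of degree at most $m$ and satisfy $$\int_0^{2\pi}g(x-x_\alpha)u(x,0)\,dx=\int_0^{2\pi}g(x-x_\alpha)u^{(m)}(x)\,dx,\quad \int_0^{2\pi}g(x-x_\alpha)\pi(x,0)\,dx=\int_0^{2\pi}g(x-x_\alpha)\pi^{(m)}(x)\,dx\quad(0\le\alpha\le 2n),$$ the initial data being distributed on this affine space of Fourier coefficients with density proportional to $e^{-\frac12|(u(\cdot,0),\pi(\cdot,0))|_A^2}$ with respect to Lebesgue measure on that affine space. Theorem. For $P$-almost every choice of the random Fourier coefficients, $\psi_r(\cdot,t)$ converges in $H^1\oplus H^0$, as $r\to\infty$, for every time $t\in\mathbb R$, to a limit $\psi_\infty(\cdot,t)$.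 Moreover, for every $r\ge0$, with probability greater than $1-\epsilon_r$, $$|\psi_r(\cdot,t)-\psi_\infty(\cdot,t)|_A<\epsilon_r\quad\text{for all } t\in\mathbb R.$$ -/

import Mathlib

noncomputable section

namespace OptimalPrediction

open MeasureTheory ProbabilityTheory

section Sobolev

open scoped ContDiff

/-! ### The energy space `H¹ ⊕ H⁰` of `2π`-periodic real functions -/

/-- Lebesgue measure on one period. -/
abbrev periodMeasure : Measure ℝ := volume.restrict (Set.Ioc 0 (2 * Real.pi))

/-- `H⁰`: real square integrable functions on one period. -/
abbrev H0 : Type := Lp ℝ 2 periodMeasure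

theorem memLp_of_continuous {f : ℝ → ℝ} (hf : Continuous f) : MemLp f 2 periodMeasure := by
  obtain ⟨C, hC⟩ := (isCompact_Icc (a := (0 : ℝ)) (b := 2 * Real.pi)).exists_bound_of_continuousOn
    hf.continuousOn
  refine MemLp.of_bound hf.aestronglyMeasurable C ?_
  filter_upwards [ae_restrict_mem measurableSet_Ioc] with x hx
  exact hC x ⟨hx.1.le, hx.2⟩

theorem integrable_mul_continuous (u : H0) {f : ℝ → ℝ} (hf : Continuous f) :
    Integrable (fun x => u x * f x) periodMeasure :=
  (Lp.memLp u).integrable_mul (memLp_of_continuous hf)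

/-- `du` is the weak derivative of the periodic function `u`: integration by parts holds against
all smooth `2π`-periodic test functions. -/
def IsWeakDeriv (u du : H0) : Prop :=
  ∀ φ : ℝ → ℝ, ContDiff ℝ ∞ φ → Function.Periodic φ (2 * Real.pi) →
    ∫ x, u x * deriv φ x ∂periodMeasure = -∫ x, du x * φ x ∂periodMeasure

/-- The periodic Sobolev space `H¹`, as the graph `{(u, u_x)}` of the weak derivative, so that
`‖u‖² = ∫ u² + u_x²`. -/
def H1 : Submodule ℝ (WithLp 2 (H0 × H0)) where
  carrier := {z | IsWeakDeriv z.fst z.snd}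
  zero_mem' := by
    intro φ _ _
    have h : ∀ f : ℝ → ℝ, ∫ x, (0 : H0) x * f x ∂periodMeasure = 0 := by
      intro f
      rw [integral_congr_ae (g := fun _ => (0 : ℝ)), integral_zero]
      filter_upwards [Lp.coeFn_zero ℝ 2 periodMeasure] with x hx
      rw [hx, Pi.zero_apply, zero_mul]
    simp only [WithLp.zero_fst, WithLp.zero_snd, h, neg_zero]
  add_mem' := by
    intro a b ha hb φ hφ hper
    have h : ∀ (u v : H0) (f : ℝ → ℝ), Continuous f → ∫ x, (u + v : H0) x * f x ∂periodMeasure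
        = ∫ x, u x * f x ∂periodMeasure + ∫ x, v x * f x ∂periodMeasure := by
      intro u v f hf
      rw [← integral_add (integrable_mul_continuous u hf) (integrable_mul_continuous v hf)]
      refine integral_congr_ae ?_
      filter_upwards [Lp.coeFn_add u v] with x hx
      rw [hx, Pi.add_apply, add_mul]
    have h1 := ha φ hφ hper
    have h2 := hb φ hφ hper
    rw [WithLp.add_fst, WithLp.add_snd, h _ _ _ (hφ.continuous_deriv (by simp)),
      h _ _ _ hφ.continuous, h1, h2]
    ring
  smul_mem' := by
    intro c a ha φ hφ hper
    have h : ∀ (u : H0) (f : ℝ → ℝ), ∫ x, (c • u : H0) x * f x ∂periodMeasure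
        = c * ∫ x, u x * f x ∂periodMeasure := by
      intro u f
      rw [← integral_const_mul]
      refine integral_congr_ae ?_
      filter_upwards [Lp.coeFn_smul c u] with x hx
      rw [hx, Pi.smul_apply, smul_eq_mul, mul_assoc]
    have h1 := ha φ hφ hper
    rw [WithLp.smul_fst, WithLp.smul_snd, h, h, h1]
    ring

/-- `H¹ ⊕ H⁰`. Its norm is the energy norm: for `(u, π)` the square of the norm is
`∫ π² + u_x² + u² dx`, twice the Klein-Gordon Hamiltonian. -/
abbrev EnergySpace : Type := WithLp 2 (H1 × H0)

/-- A continuous function as an element of `H⁰`. -/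
def toH0 (f : ℝ → ℝ) (hf : Continuous f) : H0 := (memLp_of_continuous hf).toLp f

theorem isWeakDeriv_toH0 {f : ℝ → ℝ} (hf : ContDiff ℝ 1 f)
    (hper : Function.Periodic f (2 * Real.pi)) :
    IsWeakDeriv (toH0 f hf.continuous) (toH0 (deriv f) (hf.continuous_deriv le_rfl)) := by
  intro φ hφ hφper
  have h : ∀ (g k : ℝ → ℝ) (hg : Continuous g), ∫ x, toH0 g hg x * k x ∂periodMeasure
      = ∫ x in (0 : ℝ)..(2 * Real.pi), g x * k x := by
    intro g k hg
    rw [intervalIntegral.integral_of_le Real.two_pi_pos.le]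
    refine integral_congr_ae ?_
    filter_upwards [(memLp_of_continuous hg).coeFn_toLp] with x hx
    rw [toH0, hx]
  have hd : Continuous (deriv f) := hf.continuous_deriv le_rfl
  have hφd : Continuous (deriv φ) := hφ.continuous_deriv (by simp)
  rw [h, h, intervalIntegral.integral_mul_deriv_eq_deriv_mul
    (u := f) (u' := deriv f) (v := φ) (v' := deriv φ)
    (fun x _ => (hf.differentiable (by simp) x).hasDerivAt)
    (fun x _ => (hφ.differentiable (by simp) x).hasDerivAt)
    (hd.intervalIntegrable _ _) (hφd.intervalIntegrable _ _)]
  have e1 : f (2 * Real.pi) = f 0 := by simpa using hper 0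
  have e2 : φ (2 * Real.pi) = φ 0 := by simpa using hφper 0
  rw [e1, e2]
  ring

/-- A periodic `C¹` function as an element of `H¹`. -/
def toH1 (f : ℝ → ℝ) (hf : ContDiff ℝ 1 f) (hper : Function.Periodic f (2 * Real.pi)) : H1 :=
  ⟨WithLp.toLp 2 (toH0 f hf.continuous, toH0 (deriv f) (hf.continuous_deriv le_rfl)),
    isWeakDeriv_toH0 hf hper⟩

end Sobolev

/-! ### The real trigonometric basis -/

/-- The orthonormal trigonometric functions in the order
`…, cos 2x/√π, cos x/√π, 1/√(2π), sin x/√π, sin 2x/√π, …`. A coefficient family `q` indexed by `ℤ`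
therefore encodes `a_k = q (-k)` for `k ≥ 0` and `b_k = q k` for `k ≥ 1`. -/
def trig (k : ℤ) (x : ℝ) : ℝ :=
  if k < 0 then Real.cos (k * x) / √Real.pi
  else if k = 0 then 1 / √(2 * Real.pi)
  else Real.sin (k * x) / √Real.pi

theorem contDiff_trig (k : ℤ) : ContDiff ℝ 1 (trig k) := by
  unfold trig
  split_ifs <;> fun_prop

theorem periodic_trig (k : ℤ) : Function.Periodic (trig k) (2 * Real.pi) := by
  intro x
  have h : (k : ℝ) * (x + 2 * Real.pi) = k * x + k * (2 * Real.pi) := by ring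
  unfold trig
  rw [h, Real.cos_add_int_mul_two_pi, Real.sin_add_int_mul_two_pi]

/-! ### The exact method for a linear system -/

section LinearSystem

variable {ι κ : Type} [Fintype ι] [Fintype κ] [DecidableEq ι] [DecidableEq κ]

/-- The measure `P'` on the affine space `{u | Gᵀ u = Gᵀ u₀} = u₀ + ker Gᵀ`: the Gaussian density
`exp (-½ uᵀ A u)` with respect to the Lebesgue measure of that affine space, normalized to total
mass one. Here `volume` on the subspace `ker Gᵀ` is the Lebesgue measure of its inner product. -/
def constrainedMeasure (A : Matrix ι ι ℝ) (G : Matrix ι κ ℝ) (u₀ : EuclideanSpace ℝ ι) :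
    Measure (EuclideanSpace ℝ ι) :=
  let μ : Measure (EuclideanSpace ℝ ι) :=
    (Measure.map
      (fun w : LinearMap.ker (Matrix.toEuclideanLin G.transpose) => u₀ + (w : EuclideanSpace ℝ ι))
      volume).withDensity
        (fun u => ENNReal.ofReal (Real.exp (-(1 / 2) * (u.ofLp ⬝ᵥ A.mulVec u.ofLp))))
  (μ Set.univ)⁻¹ • μ

/-- The exact mean at time `t`: the average of the solutions `u(t) = exp (t L) u(0)` of `u' = L u`
over all initial values with `Gᵀ u(0) = v₀`, where `v₀ = Gᵀ u₀`. -/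
def exactMean (L A : Matrix ι ι ℝ) (G : Matrix ι κ ℝ) (u₀ : EuclideanSpace ℝ ι) (t : ℝ) :
    EuclideanSpace ℝ ι :=
  ∫ u, Matrix.toEuclideanLin (NormedSpace.exp (t • L)) u ∂(constrainedMeasure A G u₀)

end LinearSystem

/-! ### The Klein-Gordon equation -/

/-- The indices `-m, …, m`. -/
abbrev Idx (m : ℕ) : Type := Finset.Icc (-(m : ℤ)) (m : ℤ)

/-- The matrix `Λ² = diag (k² + 1)` of `-∂ₓ² + 1` in the trigonometric basis. -/
def lambdaSq (m : ℕ) : Matrix (Idx m) (Idx m) ℝ :=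
  Matrix.diagonal fun k => ((k : ℤ) : ℝ) ^ 2 + 1

/-- The Klein-Gordon system `∂ₜ (u, π) = (π, u_xx - u)` on the Fourier coefficients `(q, p)`. -/
def kgL (m : ℕ) : Matrix (Idx m ⊕ Idx m) (Idx m ⊕ Idx m) ℝ :=
  Matrix.fromBlocks 0 1 (-lambdaSq m) 0

/-- The Hamiltonian `½ ∫ π² + u_x² + u² dx` is `½ uᵀ A u`, for `u = (q, p)` and this matrix `A`. -/
def kgA (m : ℕ) : Matrix (Idx m ⊕ Idx m) (Idx m ⊕ Idx m) ℝ :=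
  Matrix.fromBlocks (lambdaSq m) 0 0 1

/-- The averaging kernel `g(x) = (2π)⁻¹ ∑ₖ exp (-k²σ²/4) exp (ikx)`; the imaginary parts of the
terms with indices `k` and `-k` cancel. -/
def kernel (σ x : ℝ) : ℝ :=
  1 / √(2 * Real.pi) *
    ∑' k : ℤ, Real.exp (-((k : ℝ) ^ 2 * σ ^ 2 / 4)) * (Real.cos (k * x) / √(2 * Real.pi))

/-- The points `x_α = 2πα/(2n+1)`. -/
def node (n : ℕ) (α : Fin (2 * n + 1)) : ℝ := 2 * Real.pi * (α : ℕ) / (2 * n + 1)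

/-- The matrix `G` with `(Gᵀ q)_α = ∫ g(x - x_α) u(x) dx` for `u = ∑ₖ q_k trig k`. -/
def averageG (n m : ℕ) (σ : ℝ) : Matrix (Idx m) (Fin (2 * n + 1)) ℝ :=
  Matrix.of fun k α => ∫ x in (0 : ℝ)..(2 * Real.pi), kernel σ (x - node n α) * trig k x

/-- The local averages of `u` and of `π` are constrained separately. -/
def kgG (n m : ℕ) (σ : ℝ) :
    Matrix (Idx m ⊕ Idx m) (Fin (2 * n + 1) ⊕ Fin (2 * n + 1)) ℝ :=
  Matrix.fromBlocks (averageG n m σ) 0 0 (averageG n m σ)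

/-- The pair of functions `(u, π)` with Fourier coefficients `(q, p)`. -/
def field (m : ℕ) (c : EuclideanSpace ℝ (Idx m ⊕ Idx m)) : EnergySpace :=
  WithLp.toLp 2
    (∑ k : Idx m, c (Sum.inl k) • toH1 (trig k) (contDiff_trig k) (periodic_trig k),
      ∑ k : Idx m, c (Sum.inr k) • toH0 (trig k) (contDiff_trig k).continuous)

/-! ### Random Fourier coefficients -/

/-- Sample space of all Fourier coefficients: `ω (inl k)` are those of `u` and `ω (inr k)` those of
`π`, in the order of `trig`. -/
abbrev Coeffs : Type := ℤ ⊕ ℤ → ℝ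

/-- The infinite product measure: independent centred Gaussian coefficients, with variance
`1/(k² + 1)` for `u` and `1` for `π`. Its marginal on the indices `-m, …, m` is the Gaussian
measure with density proportional to `exp (-½ uᵀ A u)`, `A = kgA m`. -/
def coeffMeasure : Measure Coeffs :=
  Measure.infinitePi fun i : ℤ ⊕ ℤ =>
    gaussianReal 0 (Sum.elim (fun k : ℤ => Real.toNNReal (1 / ((k : ℝ) ^ 2 + 1))) (fun _ => 1) i)

/-- The coefficients with indices `-m, …, m`. -/
def truncate (m : ℕ) (ω : Coeffs) : EuclideanSpace ℝ (Idx m ⊕ Idx m) :=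
  WithLp.toLp 2 fun i => ω (Sum.map (fun k : Idx m => (k : ℤ)) (fun k : Idx m => (k : ℤ)) i)

/-- The `r`-th exact mean `⟨(u, π)(·, t)⟩`: the trial space consists of the trigonometric
polynomials of degree at most `m = n + r(2n+1)`, and the constraint values are those of the random
coefficients `ω` truncated to that trial space. -/
def exactSolution (n : ℕ) (σ : ℝ) (r : ℕ) (ω : Coeffs) (t : ℝ) : EnergySpace :=
  let m := n + r * (2 * n + 1)
  field m (exactMean (kgL m) (kgA m) (kgG n m σ) (truncate m ω) t)

/-- `ε_r = 4 (2n+1)^(-(ν+1)[1 + r + r²(2n+1)])`. -/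
def epsilon (n : ℕ) (ν : ℝ) (r : ℕ) : ℝ :=
  4 * (2 * (n : ℝ) + 1) ^ (-((ν + 1) * (1 + (r : ℝ) + (r : ℝ) ^ 2 * (2 * (n : ℝ) + 1))))

end OptimalPrediction

end

noncomputable section

namespace OptimalPrediction

open MeasureTheory ProbabilityTheory

/-! ### Orthogonality of the trigonometric basis -/

/-! The flow is linear and preserves the energy norm, so the exact mean at time `t` is the flow
applied to the mean of the constrained Gaussian at time 0. By the reflection symmetry of a Gaussian
density, that mean is the point of the affine constraint space that is `A`-orthogonal to its
direction, that is, the energy minimizer (`exactMean_eq`, `exactMean_kg`). The trial spaces are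
nested and the flow respects their inclusion, so the distance of two exact means does not depend on
`t` (`norm_exactSolution_sub`), and only time 0 has to be studied.

On the nodes every mode coincides, up to a factor, with a mode of index in `-n, …, n`. The node
values of those `2n+1` modes form an invertible matrix, so the constraints decouple into one scalar
equation per alias class and per component. With weights `w_l` and inverse variances `λ_l`, the
minimizer on a class is `(w_l / λ_l) x / S`, where `x = ∑ w_l q_l` is the constraint value and `S =
∑ w_l² / λ_l`. For the random coefficients `S` is also the variance of `x`, and for a larger trial
space with values `x'`, `S'` the covariance `E[x x']` is again `S`. Each class therefore contributes
`1 + 1 - 2 S / S' = 2 (S' - S) / S'` to the mean square distance (`integral_meanDist`).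

The difference `S' - S` involves only modes outside the smaller trial space, and there the Gaussian
kernel coefficients decay. With `δ = exp (-(2n+1)σ²/2)` the mean square distance is at most `16 δ^N
/ (1 - δ)` for `N = (r+1)((2n+1)r+1)`. The hypothesis on `σ` says `δ ≤ (2n+1)^(-3(ν+1))`, which
makes this bound less than `ε_r³`. Summable L² distances give almost sure convergence, Fatou's lemma
carries the bound to the limit, and Chebyshev's inequality spends `ε_r²` on the distance and leaves
`ε_r` for the probability. -/

theorem integral_cos_int_mul (k : ℤ) :
    ∫ x in (0 : ℝ)..(2 * Real.pi), Real.cos (k * x) = if k = 0 then 2 * Real.pi else 0 := by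
  split_ifs with h
  · simp [h]
  · have hk : (k : ℝ) ≠ 0 := by exact_mod_cast h
    rw [intervalIntegral.integral_comp_mul_left (fun x => Real.cos x) hk, integral_cos]
    have : Real.sin (k * (2 * Real.pi)) = 0 := by
      have := Real.sin_int_mul_pi (2 * k)
      rwa [Int.cast_mul, Int.cast_ofNat, show (2 * (k : ℝ)) * Real.pi = k * (2 * Real.pi) by ring]
        at this
    simp [this]

theorem integral_sin_int_mul (k : ℤ) :
    ∫ x in (0 : ℝ)..(2 * Real.pi), Real.sin (k * x) = 0 := by
  by_cases h : k = 0
  · simp [h]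
  · have hk : (k : ℝ) ≠ 0 := by exact_mod_cast h
    rw [intervalIntegral.integral_comp_mul_left (fun x => Real.sin x) hk, integral_sin,
      Real.cos_int_mul_two_pi]
    simp

theorem integral_cos_mul_cos (k l : ℤ) :
    ∫ x in (0 : ℝ)..(2 * Real.pi), Real.cos (k * x) * Real.cos (l * x)
      = Real.pi * ((if k = l then 1 else 0) + if k = -l then 1 else 0) := by
  have h : ∀ x : ℝ, Real.cos (k * x) * Real.cos (l * x)
      = 1 / 2 * (Real.cos ((k - l : ℤ) * x) + Real.cos ((k + l : ℤ) * x)) := by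
    intro x
    push_cast
    rw [sub_mul, add_mul, Real.cos_sub, Real.cos_add]
    ring
  simp_rw [h]
  rw [intervalIntegral.integral_const_mul, intervalIntegral.integral_add
    (Continuous.intervalIntegrable (by fun_prop) _ _)
    (Continuous.intervalIntegrable (by fun_prop) _ _), integral_cos_int_mul, integral_cos_int_mul]
  simp only [sub_eq_zero, add_eq_zero_iff_eq_neg]
  split_ifs <;> ring

theorem integral_sin_mul_sin (k l : ℤ) :
    ∫ x in (0 : ℝ)..(2 * Real.pi), Real.sin (k * x) * Real.sin (l * x)
      = Real.pi * ((if k = l then 1 else 0) - if k = -l then 1 else 0) := by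
  have h : ∀ x : ℝ, Real.sin (k * x) * Real.sin (l * x)
      = 1 / 2 * (Real.cos ((k - l : ℤ) * x) - Real.cos ((k + l : ℤ) * x)) := by
    intro x
    push_cast
    rw [sub_mul, add_mul, Real.cos_sub, Real.cos_add]
    ring
  simp_rw [h]
  rw [intervalIntegral.integral_const_mul, intervalIntegral.integral_sub
    (Continuous.intervalIntegrable (by fun_prop) _ _)
    (Continuous.intervalIntegrable (by fun_prop) _ _), integral_cos_int_mul, integral_cos_int_mul]
  simp only [sub_eq_zero, add_eq_zero_iff_eq_neg]
  split_ifs <;> ring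

theorem integral_sin_mul_cos (k l : ℤ) :
    ∫ x in (0 : ℝ)..(2 * Real.pi), Real.sin (k * x) * Real.cos (l * x) = 0 := by
  have h : ∀ x : ℝ, Real.sin (k * x) * Real.cos (l * x)
      = 1 / 2 * (Real.sin ((k - l : ℤ) * x) + Real.sin ((k + l : ℤ) * x)) := by
    intro x
    push_cast
    rw [sub_mul, add_mul, Real.sin_sub, Real.sin_add]
    ring
  simp_rw [h]
  rw [intervalIntegral.integral_const_mul, intervalIntegral.integral_add
    (Continuous.intervalIntegrable (by fun_prop) _ _)
    (Continuous.intervalIntegrable (by fun_prop) _ _), integral_sin_int_mul, integral_sin_int_mul]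
  simp

/-- The coefficient of `cos (k x)` in `trig k`. -/
def cosCoeff (k : ℤ) : ℝ := if k < 0 then 1 / √Real.pi else if k = 0 then 1 / √(2 * Real.pi) else 0

/-- The coefficient of `sin (k x)` in `trig k`. -/
def sinCoeff (k : ℤ) : ℝ := if 0 < k then 1 / √Real.pi else 0

/-- One formula for all signs of `k` lets products and derivatives be expanded uniformly; the case
split is left to the constant coefficients. -/
theorem trig_eq (k : ℤ) (x : ℝ) :
    trig k x = cosCoeff k * Real.cos (k * x) + sinCoeff k * Real.sin (k * x) := by
  unfold trig cosCoeff sinCoeff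
  rcases lt_trichotomy k 0 with h | h | h
  · simp [h, h.not_gt]; ring
  · simp [h]
  · simp [h, h.not_gt, h.ne']; ring

theorem integral_trig_mul_trig (k l : ℤ) :
    ∫ x in (0 : ℝ)..(2 * Real.pi), trig k x * trig l x = if k = l then 1 else 0 := by
  have h : ∀ x : ℝ, trig k x * trig l x
      = cosCoeff k * cosCoeff l * (Real.cos (k * x) * Real.cos (l * x))
        + sinCoeff k * sinCoeff l * (Real.sin (k * x) * Real.sin (l * x))
        + sinCoeff k * cosCoeff l * (Real.sin (k * x) * Real.cos (l * x))
        + cosCoeff k * sinCoeff l * (Real.sin (l * x) * Real.cos (k * x)) := by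
    intro x
    rw [trig_eq, trig_eq]
    ring
  simp_rw [h]
  rw [intervalIntegral.integral_add (Continuous.intervalIntegrable (by fun_prop) _ _)
      (Continuous.intervalIntegrable (by fun_prop) _ _),
    intervalIntegral.integral_add (Continuous.intervalIntegrable (by fun_prop) _ _)
      (Continuous.intervalIntegrable (by fun_prop) _ _),
    intervalIntegral.integral_add (Continuous.intervalIntegrable (by fun_prop) _ _)
      (Continuous.intervalIntegrable (by fun_prop) _ _)]
  simp only [intervalIntegral.integral_const_mul, integral_cos_mul_cos, integral_sin_mul_sin,
    integral_sin_mul_cos]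
  have h1 : (√Real.pi)⁻¹ * (√Real.pi)⁻¹ * Real.pi = 1 := by
    rw [← mul_inv, Real.mul_self_sqrt Real.pi_pos.le, inv_mul_cancel₀ Real.pi_ne_zero]
  have h2 : (√(2 : ℝ))⁻¹ * (√2)⁻¹ * 2 = 1 := by
    rw [← mul_inv, Real.mul_self_sqrt zero_le_two, inv_mul_cancel₀ two_ne_zero]
  unfold cosCoeff sinCoeff
  rcases lt_trichotomy k 0 with hk | hk | hk <;> rcases lt_trichotomy l 0 with hl | hl | hl
  · by_cases hkl : k = l
    · have : ¬ l = -l := by omega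
      simp [hkl, hl, hl.not_gt, this]; linarith
    · have : ¬ k = -l := by omega
      simp [hkl, this]
  · have : k ≠ 0 := hk.ne
    simp [hl, hk, hk.not_gt, this]
  · have : k ≠ l := by omega
    simp [hl, hk, hk.not_gt, hl.not_gt, this, hl.ne']
  · have : ¬ 0 = l := by omega
    simp [hl, hk, this, hl.ne]
  · simp [hl, hk]; linear_combination (√(2 : ℝ))⁻¹ * (√2)⁻¹ * 2 * h1 + h2
  · have : ¬ 0 = l := by omega
    simp [hk, hl.not_gt, this, hl.ne']
  · have : k ≠ l := by omega
    simp [hl, hk, hk.not_gt, hl.not_gt, this, hk.ne']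
  · have : k ≠ 0 := hk.ne'
    simp [hl, hk, hk.not_gt, this]
  · by_cases hkl : k = l
    · have : ¬ l = -l := by omega
      simp [hkl, hl, hl.not_gt, this, hl.ne']; linarith
    · have : ¬ k = -l := by omega
      simp [hkl, this]

/-- In this indexing `-k` exchanges sine and cosine, and the sign of `k` absorbs the sign of the
derivative. -/
theorem deriv_trig (k : ℤ) : deriv (trig k) = fun x => (k : ℝ) * trig (-k) x := by
  funext x
  have h1 : HasDerivAt (fun x : ℝ => (k : ℝ) * x) k x := by
    simpa using (hasDerivAt_id x).const_mul (k : ℝ)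
  have h2 : trig k = fun x => cosCoeff k * Real.cos (k * x) + sinCoeff k * Real.sin (k * x) :=
    funext (trig_eq k)
  rw [h2]
  refine ((h1.cos.const_mul _).add (h1.sin.const_mul _)).deriv.trans ?_
  rw [trig_eq]
  unfold cosCoeff sinCoeff
  rcases lt_trichotomy k 0 with h | h | h
  · simp [h, h.not_gt, h.ne]; ring
  · simp [h]
  · simp [h, h.not_gt, h.ne']; ring

/-- The addition theorem for `cos`, in terms of the trigonometric basis. -/
theorem cos_int_mul_sub (k : ℤ) (x y : ℝ) : Real.cos (k * (x - y))
    = Real.pi * (trig k x * trig k y + trig (-k) x * trig (-k) y) := by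
  have h1 : (√Real.pi)⁻¹ ^ 2 * Real.pi = 1 := by
    rw [inv_pow, Real.sq_sqrt Real.pi_pos.le, inv_mul_cancel₀ Real.pi_ne_zero]
  have h2 : (√(2 : ℝ))⁻¹ ^ 2 * 2 = 1 := by
    rw [inv_pow, Real.sq_sqrt zero_le_two, inv_mul_cancel₀ two_ne_zero]
  rw [mul_sub, Real.cos_sub]
  simp only [trig_eq]
  unfold cosCoeff sinCoeff
  rcases lt_trichotomy k 0 with h | h | h
  · simp [h, h.not_gt, h.ne]
    linear_combination (-Real.cos (k * x) * Real.cos (k * y) - Real.sin (k * x) * Real.sin (k * y)) * h1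
  · simp only [h]
    simp
    linear_combination -(√(2 : ℝ))⁻¹ ^ 2 * 2 * h1 - h2
  · simp [h, h.not_gt, h.ne']
    linear_combination (-Real.cos (k * x) * Real.cos (k * y) - Real.sin (k * x) * Real.sin (k * y)) * h1

/-! ### The energy norm in terms of Fourier coefficients -/

theorem inner_toH0 {f g : ℝ → ℝ} (hf : Continuous f) (hg : Continuous g) :
    inner ℝ (toH0 f hf) (toH0 g hg) = ∫ x in (0 : ℝ)..(2 * Real.pi), f x * g x := by
  rw [intervalIntegral.integral_of_le Real.two_pi_pos.le, L2.inner_def]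
  refine integral_congr_ae ?_
  filter_upwards [(memLp_of_continuous hf).coeFn_toLp, (memLp_of_continuous hg).coeFn_toLp]
    with x hx hy
  rw [toH0, toH0, hx, hy]
  simp [mul_comm]

theorem inner_toH0_trig (k l : ℤ) : inner ℝ (toH0 (trig k) (contDiff_trig k).continuous)
    (toH0 (trig l) (contDiff_trig l).continuous) = if k = l then 1 else 0 := by
  rw [inner_toH0, integral_trig_mul_trig]

theorem inner_toH1_trig (k l : ℤ) :
    inner ℝ (toH1 (trig k) (contDiff_trig k) (periodic_trig k))
      (toH1 (trig l) (contDiff_trig l) (periodic_trig l)) = if k = l then (k : ℝ) ^ 2 + 1 else 0 := by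
  rw [Submodule.coe_inner, toH1, toH1, WithLp.prod_inner_apply]
  simp only [inner_toH0, integral_trig_mul_trig, deriv_trig]
  have h : ∀ x : ℝ, (k : ℝ) * trig (-k) x * ((l : ℝ) * trig (-l) x)
      = (k : ℝ) * l * (trig (-k) x * trig (-l) x) := fun x => by ring
  simp_rw [h]
  rw [intervalIntegral.integral_const_mul, integral_trig_mul_trig]
  by_cases hkl : k = l
  · simp [hkl]; ring
  · simp [hkl]

theorem norm_sq_sum_of_orthogonal {E ι : Type*} [NormedAddCommGroup E] [InnerProductSpace ℝ E]
    [Fintype ι] [DecidableEq ι] (e : ι → E) (d : ι → ℝ)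
    (h : ∀ i j, inner ℝ (e i) (e j) = if i = j then d i else 0) (c : ι → ℝ) :
    ‖∑ i, c i • e i‖ ^ 2 = ∑ i, d i * c i ^ 2 := by
  rw [← real_inner_self_eq_norm_sq, sum_inner]
  refine Finset.sum_congr rfl fun i _ => ?_
  rw [inner_sum]
  simp only [real_inner_smul_left, real_inner_smul_right, h]
  simp
  ring

theorem norm_field_sq (m : ℕ) (c : EuclideanSpace ℝ (Idx m ⊕ Idx m)) :
    ‖field m c‖ ^ 2 = ∑ k : Idx m, (((k : ℤ) : ℝ) ^ 2 + 1) * c (Sum.inl k) ^ 2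
      + ∑ k : Idx m, c (Sum.inr k) ^ 2 := by
  rw [WithLp.prod_norm_sq_eq_of_L2]
  have h1 := norm_sq_sum_of_orthogonal
    (fun k : Idx m => toH1 (trig k) (contDiff_trig k) (periodic_trig k))
    (fun k => ((k : ℤ) : ℝ) ^ 2 + 1)
    (fun i j => by rw [inner_toH1_trig]; simp only [Subtype.ext_iff]) (fun k => c (Sum.inl k))
  have h2 := norm_sq_sum_of_orthogonal
    (fun k : Idx m => toH0 (trig k) (contDiff_trig k).continuous) (fun _ => 1)
    (fun i j => by rw [inner_toH0_trig]; simp only [Subtype.ext_iff]) (fun k => c (Sum.inr k))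
  simp only [one_mul] at h2
  rw [← h1, ← h2]
  rfl


/-! ### The averaging kernel in Fourier space -/

/-- The Fourier coefficients of the averaging kernel. -/
def kernelCoeff (σ : ℝ) (k : ℤ) : ℝ := Real.exp (-((k : ℝ) ^ 2 * σ ^ 2 / 4))

theorem kernelCoeff_pos (σ : ℝ) (k : ℤ) : 0 < kernelCoeff σ k := Real.exp_pos _

theorem summable_kernelCoeff {σ : ℝ} (hσ : σ ≠ 0) : Summable (kernelCoeff σ) := by
  have h : 0 < σ ^ 2 / 4 := by positivity
  have hN : Summable fun k : ℕ => Real.exp (-((k : ℝ) ^ 2 * σ ^ 2 / 4)) := by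
    refine Summable.of_nonneg_of_le (fun _ => (Real.exp_pos _).le) (fun k => ?_)
      (Real.summable_exp_nat_mul_iff.2 (neg_lt_zero.2 h))
    rw [Real.exp_le_exp]
    have : (k : ℝ) ≤ (k : ℝ) ^ 2 := by exact_mod_cast Nat.le_self_pow two_ne_zero k
    nlinarith
  refine Summable.of_nat_of_neg ?_ ?_
  · simpa [kernelCoeff] using hN
  · simpa [kernelCoeff] using hN

/-- Convolution with the kernel is diagonal in the trigonometric basis. The addition theorem splits
`cos (j (x - y))` into the modes `j` and `-j`, so mode `k` is met at `j = k` and at `j = -k`, with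
half of the coefficient each time; for `k = 0` both halves fall on the same `j`. Summability of the
coefficients, which needs `σ ≠ 0`, justifies integrating term by term. -/
theorem integral_kernel_mul_trig {σ : ℝ} (hσ : σ ≠ 0) (y : ℝ) (k : ℤ) :
    ∫ x in (0 : ℝ)..(2 * Real.pi), kernel σ (x - y) * trig k x = kernelCoeff σ k * trig k y := by
  have hcont : Continuous (trig k) := (contDiff_trig k).continuous
  have hbound : ∀ x, |trig k x| ≤ |cosCoeff k| + |sinCoeff k| := by
    intro x
    rw [trig_eq]
    refine (abs_add_le _ _).trans (add_le_add ?_ ?_)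
    · rw [abs_mul]
      exact mul_le_of_le_one_right (abs_nonneg _) (Real.abs_cos_le_one _)
    · rw [abs_mul]
      exact mul_le_of_le_one_right (abs_nonneg _) (Real.abs_sin_le_one _)
  have hsum : ∀ x : ℝ, Summable fun j : ℤ => kernelCoeff σ j * Real.cos (j * (x - y)) := by
    intro x
    refine (summable_kernelCoeff hσ).of_norm_bounded (fun j => ?_)
    rw [norm_mul, Real.norm_of_nonneg (kernelCoeff_pos σ j).le]
    exact mul_le_of_le_one_right (kernelCoeff_pos σ j).le (Real.abs_cos_le_one _)
  have hpi : √(2 * Real.pi) * √(2 * Real.pi) = 2 * Real.pi :=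
    Real.mul_self_sqrt Real.two_pi_pos.le
  have hker : ∀ x, HasSum (fun j : ℤ => (2 * Real.pi)⁻¹ * (kernelCoeff σ j
      * Real.cos (j * (x - y))) * trig k x) (kernel σ (x - y) * trig k x) := by
    intro x
    refine HasSum.mul_right _ ?_
    have h1 := (hsum x).hasSum.mul_left (2 * Real.pi)⁻¹
    have h2 : kernel σ (x - y) = (2 * Real.pi)⁻¹ * ∑' j : ℤ, kernelCoeff σ j
        * Real.cos (j * (x - y)) := by
      unfold kernel kernelCoeff
      rw [← tsum_mul_left, ← tsum_mul_left]
      refine tsum_congr fun j => ?_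
      rw [show (2 * Real.pi)⁻¹ = (√(2 * Real.pi))⁻¹ * (√(2 * Real.pi))⁻¹ by rw [← mul_inv, hpi]]
      ring
    rwa [h2]
  have hint : ∀ j : ℤ, ∫ x in (0 : ℝ)..(2 * Real.pi), (2 * Real.pi)⁻¹ * (kernelCoeff σ j
      * Real.cos (j * (x - y))) * trig k x
      = (if j = k then kernelCoeff σ k * trig k y / 2 else 0)
        + (if j = -k then kernelCoeff σ k * trig k y / 2 else 0) := by
    intro j
    have h : ∀ x : ℝ, (2 * Real.pi)⁻¹ * (kernelCoeff σ j * Real.cos (j * (x - y))) * trig k x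
        = kernelCoeff σ j / 2 * trig j y * (trig j x * trig k x)
          + kernelCoeff σ j / 2 * trig (-j) y * (trig (-j) x * trig k x) := by
      intro x
      rw [cos_int_mul_sub]
      field_simp
    have c1 : Continuous (trig j) := (contDiff_trig j).continuous
    have c2 : Continuous (trig (-j)) := (contDiff_trig (-j)).continuous
    simp_rw [h]
    rw [intervalIntegral.integral_add (Continuous.intervalIntegrable (by fun_prop) _ _)
      (Continuous.intervalIntegrable (by fun_prop) _ _), intervalIntegral.integral_const_mul,
      intervalIntegral.integral_const_mul, integral_trig_mul_trig, integral_trig_mul_trig]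
    congr 1
    · split_ifs with h1
      · rw [h1]; ring
      · ring
    · by_cases h1 : j = -k
      · have : kernelCoeff σ (-k) = kernelCoeff σ k := by simp [kernelCoeff]
        rw [h1, neg_neg, if_pos rfl, if_pos rfl, this]; ring
      · rw [if_neg h1, if_neg (by omega), mul_zero]
  have key := intervalIntegral.hasSum_integral_of_dominated_convergence
    (μ := volume) (a := 0) (b := 2 * Real.pi)
    (F := fun (j : ℤ) x => (2 * Real.pi)⁻¹ * (kernelCoeff σ j * Real.cos (j * (x - y))) * trig k x)
    (f := fun x => kernel σ (x - y) * trig k x)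
    (fun j _ => (2 * Real.pi)⁻¹ * kernelCoeff σ j * (|cosCoeff k| + |sinCoeff k|))
    (fun j => by
      refine Continuous.aestronglyMeasurable ?_
      fun_prop)
    (fun j => Filter.Eventually.of_forall fun x _ => by
      rw [norm_mul, norm_mul, norm_mul, Real.norm_of_nonneg (kernelCoeff_pos σ j).le,
        Real.norm_of_nonneg (inv_nonneg.2 Real.two_pi_pos.le)]
      refine mul_le_mul ?_ (hbound x) (abs_nonneg _)
        (mul_nonneg (inv_nonneg.2 Real.two_pi_pos.le) (kernelCoeff_pos σ j).le)
      refine mul_le_mul_of_nonneg_left ?_ (inv_nonneg.2 Real.two_pi_pos.le)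
      exact mul_le_of_le_one_right (kernelCoeff_pos σ j).le (Real.abs_cos_le_one _))
    (Filter.Eventually.of_forall fun x _ => ((summable_kernelCoeff hσ).mul_left _).mul_right _)
    (by simp)
    (Filter.Eventually.of_forall fun x _ => hker x)
  simp_rw [hint] at key
  have h2 : HasSum (fun j : ℤ => (if j = k then kernelCoeff σ k * trig k y / 2 else 0)
        + (if j = -k then kernelCoeff σ k * trig k y / 2 else 0))
      (kernelCoeff σ k * trig k y / 2 + kernelCoeff σ k * trig k y / 2) :=
    (hasSum_ite_eq k _).add (hasSum_ite_eq (-k) _)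
  rw [key.unique h2]
  ring

theorem averageG_apply {σ : ℝ} (hσ : σ ≠ 0) (n m : ℕ) (k : Idx m) (α : Fin (2 * n + 1)) :
    averageG n m σ k α = kernelCoeff σ k * trig k (node n α) :=
  integral_kernel_mul_trig hσ _ _


/-! ### Aliasing on the nodes -/

/-- The residue of `|k|` modulo `2n+1` in `-n, …, n`. -/
def residue (n : ℕ) (k : ℤ) : ℤ := Int.bmod |k| (2 * n + 1)

/-- The mode of index in `-n, …, n` with which `trig k` is aliased on the nodes. -/
def fold (n : ℕ) (k : ℤ) : ℤ := if k < 0 then -|residue n k| else |residue n k|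

/-- The factor by which `trig k` and its alias differ on the nodes. -/
def aliasCoeff (n : ℕ) (k : ℤ) : ℝ :=
  if k < 0 then (if residue n k = 0 then √2 else 1)
  else if k = 0 then 1 else ((residue n k).sign : ℝ)

theorem abs_residue_le (n : ℕ) (k : ℤ) : |residue n k| ≤ n := by
  have h1 := Int.le_bmod (x := |k|) (m := 2 * n + 1) (by omega)
  have h2 := Int.bmod_lt (x := |k|) (m := 2 * n + 1) (by omega)
  unfold residue
  rw [abs_le]
  constructor <;> omega

theorem exists_abs_eq (n : ℕ) (k : ℤ) : ∃ j : ℤ, |k| = j * (2 * n + 1) + residue n k := by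
  have h : Int.bmod |k| (2 * n + 1) % ((2 * n + 1 : ℕ) : ℤ) = |k| % ((2 * n + 1 : ℕ) : ℤ) :=
    Int.bmod_emod
  obtain ⟨j, hj⟩ := Int.ModEq.dvd h
  refine ⟨j, ?_⟩
  unfold residue
  push_cast at hj ⊢
  linarith [mul_comm j (2 * (n : ℤ) + 1)]

theorem abs_fold (n : ℕ) (k : ℤ) : |fold n k| = |residue n k| := by
  unfold fold
  split_ifs <;> simp

theorem fold_mem (n : ℕ) (k : ℤ) : fold n k ∈ Finset.Icc (-(n : ℤ)) n := by
  rw [Finset.mem_Icc, ← abs_le, abs_fold]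
  exact abs_residue_le n k

theorem residue_of_mem {n : ℕ} {k : ℤ} (hk : k ∈ Finset.Icc (-(n : ℤ)) n) : residue n k = |k| := by
  rw [Finset.mem_Icc, ← abs_le] at hk
  have := abs_nonneg k
  exact Int.bmod_eq_of_le (by push_cast; omega) (by push_cast; omega)

theorem fold_of_mem {n : ℕ} {k : ℤ} (hk : k ∈ Finset.Icc (-(n : ℤ)) n) : fold n k = k := by
  unfold fold
  rw [residue_of_mem hk]
  split_ifs with h
  · rw [abs_abs, abs_of_neg h, neg_neg]
  · rw [abs_abs, abs_of_nonneg (not_lt.1 h)]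

theorem aliasCoeff_of_mem {n : ℕ} {k : ℤ} (hk : k ∈ Finset.Icc (-(n : ℤ)) n) :
    aliasCoeff n k = 1 := by
  unfold aliasCoeff
  rw [residue_of_mem hk]
  split_ifs with h1 h2 h3
  · rw [abs_eq_zero] at h2; omega
  · rfl
  · rfl
  · rw [Int.sign_eq_one_of_pos (abs_pos.2 h3)]; simp

theorem aliasCoeff_sq_le (n : ℕ) (k : ℤ) : aliasCoeff n k ^ 2 ≤ 2 := by
  unfold aliasCoeff
  split_ifs
  · simp
  · norm_num
  · norm_num
  · obtain h | h | h := Int.sign_trichotomy (residue n k)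
    all_goals norm_num [h]

theorem cos_abs_int_mul (k : ℤ) (x : ℝ) : Real.cos ((|k| : ℤ) * x) = Real.cos (k * x) := by
  rcases abs_choice k with h | h <;> simp [h]

theorem sin_abs_int_mul (k : ℤ) (x : ℝ) :
    Real.sin (k * x) = k.sign * Real.sin ((|k| : ℤ) * x) := by
  rcases lt_trichotomy k 0 with h | h | h
  · rw [abs_of_neg h, Int.sign_eq_neg_one_of_neg h]; simp
  · simp [h]
  · rw [abs_of_pos h, Int.sign_eq_one_of_pos h]; simp

/-- Multiples of `2n+1` turn into whole periods at the nodes. -/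
theorem abs_mul_node (n : ℕ) (k : ℤ) (α : Fin (2 * n + 1)) : ∃ l : ℤ,
    ((|k| : ℤ) : ℝ) * node n α = residue n k * node n α + l * (2 * Real.pi) := by
  obtain ⟨j, hj⟩ := exists_abs_eq n k
  refine ⟨j * (α : ℕ), ?_⟩
  have h0 : (2 * (n : ℝ) + 1) ≠ 0 := by positivity
  rw [hj, node]
  push_cast
  field_simp
  ring

/-- A cosine sees only the absolute value of the residue, a sine also its sign. When the residue is
0, a cosine becomes the constant mode, whose different normalization costs `√2`, and a sine vanishes
at all nodes, in agreement with the sign of 0. -/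
theorem trig_node (n : ℕ) (k : ℤ) (α : Fin (2 * n + 1)) :
    trig k (node n α) = aliasCoeff n k * trig (fold n k) (node n α) := by
  obtain ⟨l, hl⟩ := abs_mul_node n k α
  have hs : √(2 * Real.pi) = √2 * √Real.pi := Real.sqrt_mul zero_le_two _
  have h2 : √(2 : ℝ) ≠ 0 := (Real.sqrt_pos.2 zero_lt_two).ne'
  have hp : √Real.pi ≠ 0 := (Real.sqrt_pos.2 Real.pi_pos).ne'
  rcases lt_trichotomy k 0 with h | h | h
  · have hc : Real.cos (k * node n α) = Real.cos ((|residue n k| : ℤ) * node n α) := by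
      rw [← cos_abs_int_mul, hl, Real.cos_add_int_mul_two_pi, cos_abs_int_mul]
    by_cases h0 : residue n k = 0
    · simp only [trig, aliasCoeff, fold, h, h0, if_true, hc, hs]
      simp
      field_simp
    · have : 0 < |residue n k| := abs_pos.2 h0
      simp only [trig, aliasCoeff, fold, h, h0, if_true, if_false, hc, one_mul,
        neg_lt_zero, this]
      simp
  · have hk : k ∈ Finset.Icc (-(n : ℤ)) n := by simp [h]
    rw [fold_of_mem hk, aliasCoeff_of_mem hk, one_mul]
  · have hc : Real.sin (k * node n α)
        = (residue n k).sign * Real.sin ((|residue n k| : ℤ) * node n α) := by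
      rw [← sin_abs_int_mul]
      rw [abs_of_pos h] at hl
      rw [hl, Real.sin_add_int_mul_two_pi]
    by_cases h0 : residue n k = 0
    · simp [trig, aliasCoeff, h.not_gt, h.ne', h0, hc]
    · have : 0 < |residue n k| := abs_pos.2 h0
      simp only [trig, aliasCoeff, fold, h.not_gt, h.ne', if_false, hc, this.not_gt, this.ne']
      ring

/-! ### The discrete Fourier transform on the nodes -/

/-- The Dirichlet kernel, in a form without division. -/
theorem sin_mul_sum_cos (n : ℕ) (θ : ℝ) :
    Real.sin (θ / 2) * ∑ k ∈ Finset.Icc (-(n : ℤ)) n, Real.cos (k * θ)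
      = Real.sin ((2 * n + 1) * (θ / 2)) := by
  induction n with
  | zero => simp
  | succ n ih =>
    have h : Finset.Icc (-((n + 1 : ℕ) : ℤ)) ((n + 1 : ℕ) : ℤ)
        = insert (-((n : ℤ) + 1)) (insert ((n : ℤ) + 1) (Finset.Icc (-(n : ℤ)) n)) := by
      ext x
      simp only [Finset.mem_Icc, Finset.mem_insert]
      push_cast
      omega
    rw [h, Finset.sum_insert, Finset.sum_insert, mul_add, mul_add, ih]
    · push_cast
      have e1 : (2 * ((n : ℝ) + 1) + 1) * (θ / 2) = (n + 1) * θ + θ / 2 := by ring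
      have e2 : (2 * (n : ℝ) + 1) * (θ / 2) = (n + 1) * θ - θ / 2 := by ring
      have e3 : (-1 + -(n : ℝ)) * θ = -((n + 1) * θ) := by ring
      have e4 : -((n : ℝ) + 1) * θ = -((n + 1) * θ) := by ring
      rw [e1, e2, e4, Real.cos_neg, Real.sin_add, Real.sin_sub]
      ring
    · simp
    · simp only [Finset.mem_insert, Finset.mem_Icc, not_or]
      omega

theorem sum_cos_node_sub (n : ℕ) (α β : Fin (2 * n + 1)) :
    ∑ k ∈ Finset.Icc (-(n : ℤ)) n, Real.cos (k * (node n α - node n β))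
      = if α = β then 2 * (n : ℝ) + 1 else 0 := by
  split_ifs with h
  · rw [h]
    simp
    norm_cast
    omega
  · have hsin := sin_mul_sum_cos n (node n α - node n β)
    have h0 : (2 * (n : ℝ) + 1) ≠ 0 := by positivity
    have h1 : (2 * (n : ℝ) + 1) * ((node n α - node n β) / 2)
        = (((α : ℕ) : ℤ) - ((β : ℕ) : ℤ) : ℤ) * Real.pi := by
      unfold node
      push_cast
      field_simp
    rw [h1, Real.sin_int_mul_pi] at hsin
    -- If the half-angle sine vanished, `α - β` would be a multiple of `2n+1`, which is impossible
    -- for distinct indices below `2n+1`.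
    refine (mul_eq_zero.1 hsin).resolve_left fun hz => ?_
    obtain ⟨j, hj⟩ := Real.sin_eq_zero_iff.1 hz
    have h2 : ((j * (2 * n + 1) : ℤ) : ℝ) * Real.pi
        = (((α : ℕ) : ℤ) - ((β : ℕ) : ℤ) : ℤ) * Real.pi := by
      rw [← h1, ← hj]
      push_cast
      ring
    have h3 : j * (2 * n + 1) = ((α : ℕ) : ℤ) - ((β : ℕ) : ℤ) := by
      exact_mod_cast mul_right_cancel₀ Real.pi_ne_zero h2
    have ha := α.isLt
    have hb := β.isLt
    have hab : (α : ℕ) ≠ β := fun e => h (Fin.ext e)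
    rcases lt_trichotomy j 0 with hj0 | hj0 | hj0
    · nlinarith
    · simp [hj0] at h3; omega
    · nlinarith

/-- The values of the first `2n+1` trigonometric functions on the nodes. -/
def nodeMatrix (n : ℕ) : Matrix (Idx n) (Fin (2 * n + 1)) ℝ := Matrix.of fun k α => trig k (node n α)

theorem nodeMatrix_transpose_mul (n : ℕ) :
    (nodeMatrix n).transpose * nodeMatrix n = ((2 * (n : ℝ) + 1) / (2 * Real.pi)) • 1 := by
  ext α β
  have hneg : ∑ k ∈ Finset.Icc (-(n : ℤ)) n, trig (-k) (node n α) * trig (-k) (node n β)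
      = ∑ k ∈ Finset.Icc (-(n : ℤ)) n, trig k (node n α) * trig k (node n β) := by
    refine Finset.sum_nbij' (fun k => -k) (fun k => -k) ?_ ?_ ?_ ?_ ?_ <;> simp
    · omega
    · omega
  have h := sum_cos_node_sub n α β
  simp_rw [cos_int_mul_sub] at h
  rw [← Finset.mul_sum, Finset.sum_add_distrib, hneg] at h
  simp only [Matrix.mul_apply, Matrix.transpose_apply, nodeMatrix, Matrix.of_apply,
    Matrix.smul_apply, Matrix.one_apply, smul_eq_mul]
  rw [Finset.sum_coe_sort (Finset.Icc (-(n : ℤ)) n)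
    (fun k => trig k (node n α) * trig k (node n β))]
  have hp := Real.pi_ne_zero
  field_simp
  split_ifs at h ⊢ <;> linarith

theorem eq_zero_of_nodeMatrix_transpose_mulVec {n : ℕ} {z : Idx n → ℝ}
    (h : (nodeMatrix n).transpose.mulVec z = 0) : z = 0 := by
  have hc : (2 * (n : ℝ) + 1) / (2 * Real.pi) ≠ 0 := by positivity
  have h1 : (((2 * (n : ℝ) + 1) / (2 * Real.pi))⁻¹ • (nodeMatrix n).transpose) * nodeMatrix n
      = 1 := by
    rw [Matrix.smul_mul, nodeMatrix_transpose_mul, smul_smul, inv_mul_cancel₀ hc, one_smul]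
  -- There are as many modes as nodes, so the one-sided inverse is two-sided.
  rw [Matrix.mul_eq_one_comm_of_card_eq (Fin (2 * n + 1)) (Idx n) ℝ
    (by simp; omega)] at h1
  rw [← Matrix.one_mulVec z, ← h1, ← Matrix.mulVec_mulVec, Matrix.smul_mulVec, h]
  simp

/-! ### The constraints, one alias class at a time -/

/-- The weight of mode `k` in the constraint on its alias class. -/
def weight (n : ℕ) (σ : ℝ) (k : ℤ) : ℝ := aliasCoeff n k * kernelCoeff σ k

theorem averageG_transpose_mulVec {σ : ℝ} (hσ : σ ≠ 0) (n m : ℕ) (q : Idx m → ℝ) :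
    (averageG n m σ).transpose.mulVec q = (nodeMatrix n).transpose.mulVec
      fun k => ∑ l : Idx m, if fold n l = k then weight n σ l * q l else 0 := by
  ext α
  simp only [Matrix.mulVec, dotProduct, Matrix.transpose_apply, averageG_apply hσ, nodeMatrix,
    Matrix.of_apply]
  simp_rw [Finset.mul_sum]
  rw [Finset.sum_comm]
  refine Finset.sum_congr rfl fun l _ => ?_
  rw [Finset.sum_eq_single (⟨fold n l, fold_mem n l⟩ : Idx n)]
  · rw [if_pos rfl, trig_node, weight]
    ring
  · intro k _ hk
    rw [if_neg, mul_zero]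
    exact fun e => hk (Subtype.ext e.symm)
  · simp

/-- Aliasing factors the constraint map through the invertible node matrix, so the node equations
decouple into one equation per alias class. -/
theorem averageG_transpose_mulVec_eq_zero_iff {σ : ℝ} (hσ : σ ≠ 0) (n m : ℕ) (q : Idx m → ℝ) :
    (averageG n m σ).transpose.mulVec q = 0 ↔
      ∀ k : Idx n, ∑ l : Idx m, (if fold n l = k then weight n σ l * q l else 0) = 0 := by
  rw [averageG_transpose_mulVec hσ]
  constructor
  · intro h k
    exact congrFun (eq_zero_of_nodeMatrix_transpose_mulVec h) k
  · intro h
    rw [show (fun k : Idx n => ∑ l : Idx m, if fold n l = k then weight n σ l * q l else 0) = 0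
      from funext h, Matrix.mulVec_zero]


/-! ### The mean of a Gaussian density on an affine subspace -/

section AffineGaussian

variable {E : Type*} [NormedAddCommGroup E] [InnerProductSpace ℝ E] [FiniteDimensional ℝ E]
  [MeasurableSpace E] [BorelSpace E]

/-- The unnormalized density `exp (-½ Q)` with respect to the Lebesgue measure of `a + K`. -/
def affineDensity (K : Submodule ℝ E) (Q : E → ℝ) (a : E) : Measure E :=
  (Measure.map (fun w : K => a + (w : E)) volume).withDensity
    (fun u => ENNReal.ofReal (Real.exp (-(1 / 2) * Q u)))

/-- The base point of the affine space is immaterial, so the given `u₀` may be replaced by the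
`Q`-orthogonal point. -/
theorem affineDensity_add (K : Submodule ℝ E) (Q : E → ℝ) (a : E) (b : K) :
    affineDensity K Q (a + b) = affineDensity K Q a := by
  unfold affineDensity
  congr 1
  have h : (fun w : K => a + (b : E) + (w : E)) = (fun w : K => a + (w : E)) ∘ fun w => b + w := by
    funext w
    simp [add_assoc]
  rw [h, ← Measure.map_map (by fun_prop) (by fun_prop), map_add_left_eq_self]

theorem integral_affineDensity {F : Type*} [NormedAddCommGroup F] [NormedSpace ℝ F]
    (K : Submodule ℝ E) {Q : E → ℝ} (hQ : Continuous Q) (a : E) {f : E → F} (hf : Continuous f) :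
    ∫ u, f u ∂(affineDensity K Q a)
      = ∫ w : K, Real.exp (-(1 / 2) * Q (a + w)) • f (a + w) := by
  unfold affineDensity
  rw [integral_withDensity_eq_integral_toReal_smul (by fun_prop) (by simp), integral_map (by fun_prop)]
  · simp [Real.exp_nonneg]
  · refine Continuous.aestronglyMeasurable ?_
    simp only [ENNReal.toReal_ofReal (Real.exp_nonneg _)]
    fun_prop

theorem integrable_exp_neg_quarter_norm_sq (K : Submodule ℝ E) :
    Integrable fun w : K => Real.exp (-(1 / 4) * ‖w‖ ^ 2) := by
  have h := (GaussianFourier.integrable_cexp_neg_mul_sq_norm_add (V := K) (b := (1 / 4 : ℝ))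
    (by simp) 0 0).norm
  refine h.congr (Filter.Eventually.of_forall fun w => ?_)
  simp only [Complex.norm_exp]
  congr 1
  simp [← Complex.ofReal_pow]

variable {K : Submodule ℝ E} {Q : E → ℝ} {a : E}

theorem integrable_affineDensity_id (hQ : Continuous Q) (hadd : ∀ w ∈ K, Q (a + w) = Q a + Q w)
    (hpos : ∀ w ∈ K, ‖w‖ ^ 2 ≤ Q w) : Integrable (fun u => u) (affineDensity K Q a) ∧
      IsFiniteMeasure (affineDensity K Q a) := by
  -- The Gaussian factor is split into two equal ones: one is kept for integrability, the other
  -- absorbs the linear growth of `a + w`.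
  have hexp : ∀ w : K, Real.exp (-(1 / 2) * Q (a + w))
      ≤ Real.exp (-(1 / 2) * Q a) * (Real.exp (-(1 / 4) * ‖w‖ ^ 2) * Real.exp (-(1 / 4) * ‖w‖ ^ 2)) := by
    intro w
    rw [← Real.exp_add, ← Real.exp_add, Real.exp_le_exp, hadd w w.2]
    have := hpos w w.2
    rw [Submodule.coe_norm]
    linarith
  have hone : ∀ w : K, Real.exp (-(1 / 4) * ‖w‖ ^ 2) ≤ 1 := fun w => by
    rw [Real.exp_le_one_iff]
    nlinarith [sq_nonneg ‖w‖]
  have hlin : ∀ w : K, ‖w‖ * Real.exp (-(1 / 4) * ‖w‖ ^ 2) ≤ 1 := fun w => by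
    rw [neg_mul, Real.exp_neg, mul_inv_le_iff₀ (Real.exp_pos _), one_mul]
    have := Real.add_one_le_exp (1 / 4 * ‖w‖ ^ 2)
    nlinarith [sq_nonneg (‖w‖ / 2 - 1)]
  have hint0 := integrable_exp_neg_quarter_norm_sq K
  have hexp1 : ∀ w : K, Real.exp (-(1 / 2) * Q (a + w))
      ≤ Real.exp (-(1 / 2) * Q a) * Real.exp (-(1 / 4) * ‖w‖ ^ 2) := fun w =>
    (hexp w).trans (mul_le_mul_of_nonneg_left
      (mul_le_of_le_one_left (Real.exp_nonneg _) (hone w)) (Real.exp_nonneg _))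
  have hint1 : Integrable fun w : K => Real.exp (-(1 / 2) * Q (a + w)) := by
    refine (hint0.const_mul (Real.exp (-(1 / 2) * Q a))).mono'
      (Continuous.aestronglyMeasurable (by fun_prop)) (Filter.Eventually.of_forall fun w => ?_)
    rw [Real.norm_of_nonneg (Real.exp_nonneg _)]
    exact hexp1 w
  have hint2 : Integrable fun w : K => Real.exp (-(1 / 2) * Q (a + w)) • (a + (w : E)) := by
    refine (hint0.const_mul (Real.exp (-(1 / 2) * Q a) * (‖a‖ + 1))).mono'
      (Continuous.aestronglyMeasurable (by fun_prop)) (Filter.Eventually.of_forall fun w => ?_)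
    rw [norm_smul, Real.norm_of_nonneg (Real.exp_nonneg _)]
    have h1 : ‖a + (w : E)‖ ≤ ‖a‖ + ‖w‖ := norm_add_le _ _
    set e := Real.exp (-(1 / 2) * Q a)
    have he : 0 < e := Real.exp_pos _
    set f := Real.exp (-(1 / 4) * ‖w‖ ^ 2)
    have hf : 0 < f := Real.exp_pos _
    calc Real.exp (-(1 / 2) * Q (a + w)) * ‖a + (w : E)‖
        ≤ Real.exp (-(1 / 2) * Q (a + w)) * (‖a‖ + ‖w‖) :=
          mul_le_mul_of_nonneg_left h1 (Real.exp_nonneg _)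
      _ ≤ e * f * ‖a‖ + e * (f * f) * ‖w‖ := by
          rw [mul_add]
          exact add_le_add (mul_le_mul_of_nonneg_right (hexp1 w) (norm_nonneg _))
            (mul_le_mul_of_nonneg_right (hexp w) (norm_nonneg _))
      _ = e * f * ‖a‖ + e * f * (‖w‖ * f) := by ring
      _ ≤ e * f * ‖a‖ + e * f * 1 := by gcongr; exact hlin w
      _ = e * (‖a‖ + 1) * f := by ring
  have hmeas : AEMeasurable (fun w : K => a + (w : E)) volume := by fun_prop
  have hd : Measurable fun u => ENNReal.ofReal (Real.exp (-(1 / 2) * Q u)) := by fun_prop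
  constructor
  · unfold affineDensity
    rw [integrable_withDensity_iff_integrable_smul' hd (by simp), integrable_map_measure _ hmeas]
    · refine hint2.congr (Filter.Eventually.of_forall fun w => ?_)
      simp [Real.exp_nonneg]
    · refine Continuous.aestronglyMeasurable ?_
      simp only [ENNReal.toReal_ofReal (Real.exp_nonneg _)]
      fun_prop
  · refine ⟨?_⟩
    unfold affineDensity
    rw [withDensity_apply _ MeasurableSet.univ, Measure.restrict_univ, lintegral_map hd (by fun_prop)]
    exact hint1.lintegral_lt_top

theorem affineDensity_univ_ne_zero (hQ : Continuous Q) : affineDensity K Q a Set.univ ≠ 0 := by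
  unfold affineDensity
  rw [withDensity_apply _ MeasurableSet.univ, Measure.restrict_univ,
    lintegral_map (by fun_prop) (by fun_prop), Ne, lintegral_eq_zero_iff (by fun_prop)]
  intro h
  have h2 : ∀ᵐ w : K, False := by
    filter_upwards [h] with w hw
    simp only [Pi.zero_apply, ENNReal.ofReal_eq_zero] at hw
    exact absurd hw (not_le.2 (Real.exp_pos _))
  rw [Filter.eventually_false_iff_eq_bot, ae_eq_bot] at h2
  exact NeZero.ne (volume : Measure K) h2

/-- If `a` is `Q`-orthogonal to `K`, then `a` is the mean of the density `exp (-½ Q)` on `a + K`. -/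
theorem integral_affineDensity_normalized {F : Type*} [NormedAddCommGroup F] [NormedSpace ℝ F]
    [CompleteSpace F] (hQ : Continuous Q)
    (hadd : ∀ w ∈ K, Q (a + w) = Q a + Q w) (hneg : ∀ w ∈ K, Q (-w) = Q w)
    (hpos : ∀ w ∈ K, ‖w‖ ^ 2 ≤ Q w) (T : E →L[ℝ] F) :
    ∫ u, T u ∂((affineDensity K Q a Set.univ)⁻¹ • affineDensity K Q a) = T a := by
  obtain ⟨hint, hfin⟩ := integrable_affineDensity_id hQ hadd hpos
  have h0 := affineDensity_univ_ne_zero (K := K) (a := a) hQ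
  -- By orthogonality the density at `a + w` is even in `w`, so the centred first moment equals its
  -- own negative.
  have hodd : ∫ u, (u - a) ∂(affineDensity K Q a) = 0 := by
    rw [integral_affineDensity K hQ a (by fun_prop)]
    have h := integral_neg_eq_self
      (fun w : K => Real.exp (-(1 / 2) * Q (a + w)) • (a + (w : E) - a)) volume
    have h1 : ∀ w : K, Real.exp (-(1 / 2) * Q (a + (-w : K))) • (a + ((-w : K) : E) - a)
        = -(Real.exp (-(1 / 2) * Q (a + w)) • (a + (w : E) - a)) := by
      intro w
      rw [hadd _ w.2, hadd _ (-w).2, Submodule.coe_neg, hneg _ w.2]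
      simp
    simp_rw [h1] at h
    rw [integral_neg] at h
    have h2 : ∀ x : E, -x = x → x = 0 := fun x hx => by
      have h3 : (2 : ℝ) • x = 0 := by
        rw [two_smul]
        nth_rewrite 1 [← hx]
        exact neg_add_cancel x
      exact (smul_eq_zero.1 h3).resolve_left two_ne_zero
    exact h2 _ h
  have hmean : ∫ u, u ∂(affineDensity K Q a) = (affineDensity K Q a).real Set.univ • a := by
    rw [integral_sub hint (integrable_const a), integral_const, sub_eq_zero] at hodd
    exact hodd
  rw [integral_smul_measure, T.integral_comp_comm hint, hmean, map_smul, smul_smul,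
    ENNReal.toReal_inv, Measure.real, inv_mul_cancel₀, one_smul]
  exact (ENNReal.toReal_pos h0 (measure_ne_top _ _)).ne'

end AffineGaussian

section LinearSystem

variable {ι κ : Type} [Fintype ι] [DecidableEq ι]

/-- The exact mean evolves from the element of the constraint space that is `A`-orthogonal to its
direction. -/
theorem exactMean_eq (L A : Matrix ι ι ℝ) (G : Matrix ι κ ℝ) (u₀ a : EuclideanSpace ℝ ι) (t : ℝ)
    (hsymm : A.IsSymm) (hA : ∀ x : ι → ℝ, x ⬝ᵥ x ≤ x ⬝ᵥ A.mulVec x)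
    (ha : G.transpose.mulVec (a - u₀).ofLp = 0)
    (horth : ∀ w : ι → ℝ, G.transpose.mulVec w = 0 → w ⬝ᵥ A.mulVec a.ofLp = 0) :
    exactMean L A G u₀ t = Matrix.toEuclideanLin (NormedSpace.exp (t • L)) a := by
  set K := LinearMap.ker (Matrix.toEuclideanLin G.transpose)
  set Q : EuclideanSpace ℝ ι → ℝ := fun u => u.ofLp ⬝ᵥ A.mulVec u.ofLp
  have hK : ∀ w : EuclideanSpace ℝ ι, w ∈ K ↔ G.transpose.mulVec w.ofLp = 0 := by
    intro w
    rw [LinearMap.mem_ker, Matrix.toLpLin_apply]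
    exact (WithLp.toLp_eq_zero 2)
  have hc : constrainedMeasure A G u₀
      = (affineDensity K Q a Set.univ)⁻¹ • affineDensity K Q a := by
    have h := affineDensity_add K Q u₀ ⟨a - u₀, (hK _).2 ha⟩
    simp only [add_sub_cancel] at h
    rw [h]
    rfl
  have hQ : Continuous Q := by
    simp only [Q, dotProduct, Matrix.mulVec]
    fun_prop
  rw [exactMean, hc]
  refine integral_affineDensity_normalized hQ ?_ ?_ ?_
    (Matrix.toEuclideanLin (NormedSpace.exp (t • L))).toContinuousLinearMap
  · intro w hw
    have h1 := horth w.ofLp ((hK w).1 hw)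
    have h2 : a.ofLp ⬝ᵥ A.mulVec w.ofLp = 0 := by
      rw [Matrix.dotProduct_mulVec, ← Matrix.mulVec_transpose, hsymm, dotProduct_comm]
      exact h1
    simp only [Q, WithLp.ofLp_add, Matrix.mulVec_add, add_dotProduct, dotProduct_add, h1, h2]
    ring
  · intro w _
    simp [Q, Matrix.mulVec_neg]
  · intro w _
    rw [EuclideanSpace.real_norm_sq_eq]
    refine le_trans (le_of_eq ?_) (hA w.ofLp)
    simp [dotProduct, sq]

end LinearSystem


/-! ### The Klein-Gordon flow -/

/-- Intertwining passes to powers and hence to exponentials. It is used with `J = A` for energy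
conservation and with `J` the extension by zero for the compatibility of the flows. -/
theorem exp_mul_eq_mul_exp {ι κ : Type*} [Fintype ι] [Fintype κ] [DecidableEq ι]
    [DecidableEq κ] (L : Matrix ι ι ℝ) (M : Matrix κ κ ℝ) (J : Matrix κ ι ℝ) (h : M * J = J * L) :
    NormedSpace.exp M * J = J * NormedSpace.exp L := by
  have hpow : ∀ n : ℕ, M ^ n * J = J * L ^ n := by
    intro n
    induction n with
    | zero => simp
    | succ n ih => rw [pow_succ, Matrix.mul_assoc, h, ← Matrix.mul_assoc, ih, Matrix.mul_assoc,
        ← pow_succ]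
  let _ : NormedRing (Matrix ι ι ℝ) := Matrix.linftyOpNormedRing
  let _ : NormedAlgebra ℝ (Matrix ι ι ℝ) := Matrix.linftyOpNormedAlgebra
  let _ : NormedRing (Matrix κ κ ℝ) := Matrix.linftyOpNormedRing
  let _ : NormedAlgebra ℝ (Matrix κ κ ℝ) := Matrix.linftyOpNormedAlgebra
  have h1 := (NormedSpace.exp_series_hasSum_exp' (𝕂 := ℝ) L).map
    (AddMonoidHom.mk' (fun X : Matrix ι ι ℝ => J * X) (Matrix.mul_add J))
    (by simp only [AddMonoidHom.mk'_apply]; fun_prop)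
  have h2 := (NormedSpace.exp_series_hasSum_exp' (𝕂 := ℝ) M).map
    (AddMonoidHom.mk' (fun X : Matrix κ κ ℝ => X * J) (fun X Y => Matrix.add_mul X Y J))
    (by simp only [AddMonoidHom.mk'_apply]; fun_prop)
  have e : (AddMonoidHom.mk' (fun X : Matrix κ κ ℝ => X * J) (fun X Y => Matrix.add_mul X Y J)) ∘
      (fun n : ℕ => ((n.factorial : ℝ))⁻¹ • M ^ n)
      = (AddMonoidHom.mk' (fun X : Matrix ι ι ℝ => J * X) (Matrix.mul_add J)) ∘
      (fun n : ℕ => ((n.factorial : ℝ))⁻¹ • L ^ n) := by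
    funext n
    simp [hpow]
  rw [e] at h2
  exact h2.unique h1

/-- `L` is skew-adjoint for the energy form, the infinitesimal version of energy conservation. -/
theorem kgL_transpose_mul_kgA (m : ℕ) : (kgL m).transpose * kgA m = -(kgA m * kgL m) := by
  have : (lambdaSq m).transpose = lambdaSq m := Matrix.diagonal_transpose _
  simp [kgL, kgA, Matrix.fromBlocks_transpose, Matrix.fromBlocks_multiply, this,
    Matrix.fromBlocks_neg]

theorem exp_kgL_transpose_mul (m : ℕ) (t : ℝ) :
    (NormedSpace.exp (t • kgL m)).transpose * kgA m * NormedSpace.exp (t • kgL m) = kgA m := by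
  rw [← Matrix.exp_transpose]
  have h : (t • kgL m).transpose * kgA m = kgA m * -(t • kgL m) := by
    rw [Matrix.transpose_smul, Matrix.smul_mul, kgL_transpose_mul_kgA, Matrix.mul_neg,
      Matrix.mul_smul, smul_neg]
  rw [exp_mul_eq_mul_exp _ _ _ h, Matrix.mul_assoc, ← Matrix.exp_add_of_commute,
    neg_add_cancel, NormedSpace.exp_zero, Matrix.mul_one]
  exact (Commute.refl _).neg_left

theorem norm_field_sq_eq_dotProduct (m : ℕ) (c : EuclideanSpace ℝ (Idx m ⊕ Idx m)) :
    ‖field m c‖ ^ 2 = c.ofLp ⬝ᵥ (kgA m).mulVec c.ofLp := by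
  rw [norm_field_sq]
  have h : (kgA m).mulVec c.ofLp = Sum.elim (fun k : Idx m => (((k : ℤ) : ℝ) ^ 2 + 1) * c (Sum.inl k))
      (fun k : Idx m => c (Sum.inr k)) := by
    rw [kgA, Matrix.fromBlocks_mulVec]
    funext i
    rcases i with i | i
    · simp [lambdaSq, Matrix.mulVec_diagonal]
    · simp
  rw [h, dotProduct, Fintype.sum_sum_type]
  simp only [Sum.elim_inl, Sum.elim_inr]
  congr 1 <;> exact Finset.sum_congr rfl fun _ _ => by ring

/-- The solution operator of the Klein-Gordon system on the Fourier coefficients. -/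
def flow (m : ℕ) (t : ℝ) (c : EuclideanSpace ℝ (Idx m ⊕ Idx m)) : EuclideanSpace ℝ (Idx m ⊕ Idx m) :=
  Matrix.toEuclideanLin (NormedSpace.exp (t • kgL m)) c

/-- The flow preserves the energy norm. -/
theorem norm_field_flow (m : ℕ) (t : ℝ) (c : EuclideanSpace ℝ (Idx m ⊕ Idx m)) :
    ‖field m (flow m t c)‖ = ‖field m c‖ := by
  rw [← sq_eq_sq₀ (norm_nonneg _) (norm_nonneg _), norm_field_sq_eq_dotProduct,
    norm_field_sq_eq_dotProduct, flow, Matrix.toLpLin_apply]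
  simp only
  rw [Matrix.mulVec_mulVec, Matrix.dotProduct_mulVec, ← Matrix.mulVec_transpose,
    Matrix.mulVec_mulVec, Matrix.transpose_mul, ← Matrix.exp_transpose]
  have hA : (kgA m).transpose = kgA m := by
    simp [kgA, lambdaSq, Matrix.fromBlocks_transpose]
  rw [hA, Matrix.exp_transpose, exp_kgL_transpose_mul, dotProduct_comm]

/-! ### Extension by zero to a larger trial space -/

/-- The Fourier coefficients with indices `-m, …, m` as coefficients with indices `-m', …, m'`. -/
def extendMatrix (m m' : ℕ) : Matrix (Idx m') (Idx m) ℝ :=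
  Matrix.of fun k l => if (k : ℤ) = l then 1 else 0

/-- The matrix `extendMatrix` on both components. -/
def extendMatrixPair (m m' : ℕ) : Matrix (Idx m' ⊕ Idx m') (Idx m ⊕ Idx m) ℝ :=
  Matrix.fromBlocks (extendMatrix m m') 0 0 (extendMatrix m m')

theorem kgL_mul_extendMatrixPair (m m' : ℕ) :
    kgL m' * extendMatrixPair m m' = extendMatrixPair m m' * kgL m := by
  have h : lambdaSq m' * extendMatrix m m' = extendMatrix m m' * lambdaSq m := by
    ext k l
    simp only [lambdaSq, extendMatrix, Matrix.diagonal_mul, Matrix.mul_diagonal, Matrix.of_apply]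
    split_ifs with h
    · rw [h]; ring
    · ring
  simp [kgL, extendMatrixPair, Matrix.fromBlocks_multiply, h]

/-- Extension by zero of the Fourier coefficients. -/
def extend (m m' : ℕ) (c : EuclideanSpace ℝ (Idx m ⊕ Idx m)) :
    EuclideanSpace ℝ (Idx m' ⊕ Idx m') :=
  WithLp.toLp 2 ((extendMatrixPair m m').mulVec c.ofLp)

theorem flow_extend (m m' : ℕ) (t : ℝ) (c : EuclideanSpace ℝ (Idx m ⊕ Idx m)) :
    flow m' t (extend m m' c) = extend m m' (flow m t c) := by
  have h := exp_mul_eq_mul_exp (t • kgL m) (t • kgL m') (extendMatrixPair m m')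
    (by rw [Matrix.smul_mul, Matrix.mul_smul, kgL_mul_extendMatrixPair])
  simp only [flow, extend, Matrix.toLpLin_apply, Matrix.mulVec_mulVec, h]

theorem extend_inl (m m' : ℕ) (c : EuclideanSpace ℝ (Idx m ⊕ Idx m)) (k : Idx m') :
    extend m m' c (Sum.inl k)
      = ∑ l : Idx m, (if (k : ℤ) = l then 1 else 0) * c (Sum.inl l) := by
  simp only [extend, extendMatrixPair, Matrix.fromBlocks_mulVec, Sum.elim_inl, Matrix.zero_mulVec,
    add_zero]
  rfl

theorem extend_inr (m m' : ℕ) (c : EuclideanSpace ℝ (Idx m ⊕ Idx m)) (k : Idx m') :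
    extend m m' c (Sum.inr k)
      = ∑ l : Idx m, (if (k : ℤ) = l then 1 else 0) * c (Sum.inr l) := by
  simp only [extend, extendMatrixPair, Matrix.fromBlocks_mulVec, Sum.elim_inr, Matrix.zero_mulVec,
    zero_add]
  rfl

theorem sum_extend_smul {E : Type*} [AddCommGroup E] [Module ℝ E] {m m' : ℕ} (h : m ≤ m')
    (e : ℤ → E) (c : Idx m → ℝ) :
    ∑ k : Idx m', (∑ l : Idx m, (if (k : ℤ) = l then 1 else 0) * c l) • e k
      = ∑ l : Idx m, c l • e l := by
  simp_rw [Finset.sum_smul]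
  rw [Finset.sum_comm]
  refine Finset.sum_congr rfl fun l _ => ?_
  have hl := Finset.mem_Icc.1 l.2
  rw [Finset.sum_eq_single (⟨l, Finset.mem_Icc.2 (by omega)⟩ : Idx m')]
  · simp
  · intro k _ hk
    rw [if_neg (fun h => hk (Subtype.ext h)), zero_mul, zero_smul]
  · simp

theorem field_extend {m m' : ℕ} (h : m ≤ m') (c : EuclideanSpace ℝ (Idx m ⊕ Idx m)) :
    field m' (extend m m' c) = field m c := by
  unfold field
  simp only [extend_inl, extend_inr]
  rw [← sum_extend_smul h (fun k => toH1 (trig k) (contDiff_trig k) (periodic_trig k)),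
    ← sum_extend_smul h (fun k => toH0 (trig k) (contDiff_trig k).continuous)]

theorem field_sub (m : ℕ) (c d : EuclideanSpace ℝ (Idx m ⊕ Idx m)) :
    field m (c - d) = field m c - field m d := by
  unfold field
  simp only [PiLp.sub_apply, sub_smul, Finset.sum_sub_distrib]
  rfl

theorem flow_sub (m : ℕ) (t : ℝ) (c d : EuclideanSpace ℝ (Idx m ⊕ Idx m)) :
    flow m t (c - d) = flow m t c - flow m t d := map_sub _ _ _

/-- After extension by zero both states evolve under the same isometric flow. -/
theorem norm_field_flow_sub {m m' : ℕ} (h : m ≤ m') (t : ℝ) (c : EuclideanSpace ℝ (Idx m ⊕ Idx m))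
    (c' : EuclideanSpace ℝ (Idx m' ⊕ Idx m')) :
    ‖field m (flow m t c) - field m' (flow m' t c')‖ = ‖field m c - field m' c'‖ := by
  rw [← field_extend h, ← flow_extend, ← field_sub, ← flow_sub, norm_field_flow, field_sub,
    field_extend h]


/-! ### The minimizer of the energy under the constraints -/

/-- The indices `-m, …, m`, as a finite set of integers. -/
abbrev modes (m : ℕ) : Finset ℤ := Finset.Icc (-(m : ℤ)) m

/-- The modes of index in `-m, …, m` that are aliased with mode `k`. -/
def aliasClass (n m : ℕ) (k : ℤ) : Finset ℤ := {l ∈ modes m | fold n l = k}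

/-- The value of the constraint on the alias class of `k`. -/
def classSum (n m : ℕ) (σ : ℝ) (q : ℤ → ℝ) (k : ℤ) : ℝ :=
  ∑ l ∈ aliasClass n m k, weight n σ l * q l

/-- The squared norm of the constraint on the alias class of `k`, dual to `∑ lam q²`. -/
def classNormSq (n m : ℕ) (σ : ℝ) (lam : ℤ → ℝ) (k : ℤ) : ℝ :=
  ∑ l ∈ aliasClass n m k, weight n σ l ^ 2 / lam l

/-- The minimizer of `∑ lam q²` with the same constraint values as `q`. -/
def minimizer (n m : ℕ) (σ : ℝ) (lam q : ℤ → ℝ) (l : ℤ) : ℝ :=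
  weight n σ l / lam l * (classSum n m σ q (fold n l) / classNormSq n m σ lam (fold n l))

theorem mem_aliasClass {n m : ℕ} {k l : ℤ} : l ∈ aliasClass n m k ↔ l ∈ modes m ∧ fold n l = k :=
  Finset.mem_filter

theorem modes_subset {m m' : ℕ} (h : m ≤ m') : modes m ⊆ modes m' :=
  Finset.Icc_subset_Icc (by omega) (by omega)

theorem aliasClass_subset {n m m' : ℕ} (h : m ≤ m') (k : ℤ) :
    aliasClass n m k ⊆ aliasClass n m' k :=
  Finset.filter_subset_filter _ (modes_subset h)

theorem sum_modes_eq_sum_aliasClass (n m : ℕ) (f : ℤ → ℝ) :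
    ∑ l ∈ modes m, f l = ∑ k ∈ modes n, ∑ l ∈ aliasClass n m k, f l :=
  (Finset.sum_fiberwise_of_maps_to (fun l _ => fold_mem n l) f).symm

theorem self_mem_aliasClass {n m : ℕ} (h : n ≤ m) {k : ℤ} (hk : k ∈ modes n) :
    k ∈ aliasClass n m k :=
  mem_aliasClass.2 ⟨modes_subset h hk, fold_of_mem hk⟩

variable {n m : ℕ} {σ : ℝ} {lam : ℤ → ℝ}

theorem weight_of_mem {k : ℤ} (hk : k ∈ modes n) : weight n σ k = kernelCoeff σ k := by
  rw [weight, aliasCoeff_of_mem hk, one_mul]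

theorem kernelCoeff_sq_div_le_classNormSq (hlam : ∀ l, 0 < lam l) (h : n ≤ m) {k : ℤ}
    (hk : k ∈ modes n) : kernelCoeff σ k ^ 2 / lam k ≤ classNormSq n m σ lam k := by
  rw [← weight_of_mem hk]
  exact Finset.single_le_sum (f := fun l => weight n σ l ^ 2 / lam l)
    (fun l _ => div_nonneg (sq_nonneg _) (hlam l).le) (self_mem_aliasClass h hk)

theorem classNormSq_pos (hlam : ∀ l, 0 < lam l) (h : n ≤ m) {k : ℤ} (hk : k ∈ modes n) :
    0 < classNormSq n m σ lam k :=
  (div_pos (pow_pos (kernelCoeff_pos σ k) 2) (hlam k)).trans_le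
    (kernelCoeff_sq_div_le_classNormSq hlam h hk)

theorem classSum_minimizer (hlam : ∀ l, 0 < lam l) (h : n ≤ m) (q : ℤ → ℝ) {k : ℤ}
    (hk : k ∈ modes n) :
    ∑ l ∈ aliasClass n m k, weight n σ l * minimizer n m σ lam q l = classSum n m σ q k := by
  have h0 := (classNormSq_pos (σ := σ) hlam h hk).ne'
  have h1 : ∀ l ∈ aliasClass n m k, weight n σ l * minimizer n m σ lam q l
      = weight n σ l ^ 2 / lam l * (classSum n m σ q k / classNormSq n m σ lam k) := by
    intro l hl
    rw [minimizer, (mem_aliasClass.1 hl).2]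
    ring
  rw [Finset.sum_congr rfl h1, ← Finset.sum_mul]
  exact mul_div_cancel₀ _ h0

/-- The Lagrange condition: on each class `lam l * minimizer l` is a constant multiple of `weight
l`, so it annihilates every variation that preserves the constraint. -/
theorem sum_mul_minimizer_eq_zero (hlam : ∀ l, 0 < lam l) (q z : ℤ → ℝ)
    (hz : ∀ k ∈ modes n, ∑ l ∈ aliasClass n m k, weight n σ l * z l = 0) :
    ∑ l ∈ modes m, z l * (lam l * minimizer n m σ lam q l) = 0 := by
  rw [sum_modes_eq_sum_aliasClass n]
  refine Finset.sum_eq_zero fun k hk => ?_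
  have h1 : ∀ l ∈ aliasClass n m k, z l * (lam l * minimizer n m σ lam q l)
      = weight n σ l * z l * (classSum n m σ q k / classNormSq n m σ lam k) := by
    intro l hl
    rw [minimizer, (mem_aliasClass.1 hl).2]
    have := (hlam l).ne'
    field_simp
  rw [Finset.sum_congr rfl h1, ← Finset.sum_mul, hz k hk, zero_mul]

/-- The squared distance of the minimizers in two nested trial spaces. -/
theorem sum_mul_minimizer_sub_sq (hlam : ∀ l, 0 < lam l) {m' : ℕ} (h : n ≤ m) (h' : m ≤ m')
    (q : ℤ → ℝ) :
    ∑ l ∈ modes m', lam l * ((if l ∈ modes m then minimizer n m σ lam q l else 0)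
        - minimizer n m' σ lam q l) ^ 2
      = ∑ k ∈ modes n, (classSum n m σ q k ^ 2 / classNormSq n m σ lam k
        + classSum n m' σ q k ^ 2 / classNormSq n m' σ lam k
        - 2 * (classSum n m σ q k * classSum n m' σ q k) / classNormSq n m' σ lam k) := by
  rw [sum_modes_eq_sum_aliasClass n]
  refine Finset.sum_congr rfl fun k hk => ?_
  set S := classNormSq n m σ lam k with hS
  set S' := classNormSq n m' σ lam k with hS'
  set x := classSum n m σ q k with hx
  set x' := classSum n m' σ q k with hx'
  have hS0 : S ≠ 0 := (classNormSq_pos hlam h hk).ne'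
  have hS0' : S' ≠ 0 := (classNormSq_pos hlam (h.trans h') hk).ne'
  -- On one class both minimizers are multiples of `weight / lam`, with factors `x / S` and `x' /
  -- S'`; the first is present only on the smaller class.
  have h1 : ∀ l ∈ aliasClass n m' k, lam l * ((if l ∈ modes m then minimizer n m σ lam q l else 0)
        - minimizer n m' σ lam q l) ^ 2
      = (if l ∈ aliasClass n m k then weight n σ l ^ 2 / lam l else 0)
          * ((x / S) ^ 2 - 2 * (x / S) * (x' / S'))
        + weight n σ l ^ 2 / lam l * (x' / S') ^ 2 := by
    intro l hl
    have hl' := (mem_aliasClass.1 hl).2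
    have := (hlam l).ne'
    simp only [mem_aliasClass, hl', and_true, minimizer, ← hS, ← hS', ← hx, ← hx']
    split_ifs
    · field_simp
      ring
    · field_simp
      ring
  rw [Finset.sum_congr rfl h1, Finset.sum_add_distrib, ← Finset.sum_mul, ← Finset.sum_mul,
    Finset.sum_ite_mem, Finset.inter_eq_right.2 (aliasClass_subset h' k)]
  change S * _ + S' * _ = _
  field_simp
  ring

/-! ### The exact mean as a minimizer -/

/-- The inverse variances of the Fourier coefficients of `u`. -/
def lamU (k : ℤ) : ℝ := (k : ℝ) ^ 2 + 1

theorem lamU_pos (k : ℤ) : 0 < lamU k := by unfold lamU; positivity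

/-- The Fourier coefficients of the `m`-th exact mean at time `0`. -/
def meanCoeff (n m : ℕ) (σ : ℝ) (ω : Coeffs) : EuclideanSpace ℝ (Idx m ⊕ Idx m) :=
  WithLp.toLp 2 (Sum.elim
    (fun l : Idx m => minimizer n m σ lamU (fun k => ω (Sum.inl k)) l)
    (fun l : Idx m => minimizer n m σ (fun _ => 1) (fun k => ω (Sum.inr k)) l))

theorem sum_idx_ite_fold (n m : ℕ) (f : ℤ → ℝ) (k : ℤ) :
    ∑ l : Idx m, (if fold n l = k then f l else 0) = ∑ l ∈ aliasClass n m k, f l := by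
  rw [Finset.sum_coe_sort (modes m) (fun l => if fold n l = k then f l else 0), aliasClass,
    Finset.sum_filter]

theorem averageG_transpose_mulVec_minimizer_sub (hσ : σ ≠ 0) (hlam : ∀ l, 0 < lam l) (h : n ≤ m)
    (q : ℤ → ℝ) : (averageG n m σ).transpose.mulVec
      (fun l : Idx m => minimizer n m σ lam q l - q l) = 0 := by
  rw [averageG_transpose_mulVec_eq_zero_iff hσ]
  intro k
  rw [sum_idx_ite_fold n m (fun l => weight n σ l * (minimizer n m σ lam q l - q l))]
  simp_rw [mul_sub]
  rw [Finset.sum_sub_distrib, classSum_minimizer hlam h q k.2, classSum, sub_self]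

theorem sum_idx_mul_minimizer_eq_zero (hσ : σ ≠ 0) (hlam : ∀ l, 0 < lam l) (q : ℤ → ℝ)
    {w : Idx m → ℝ} (hw : (averageG n m σ).transpose.mulVec w = 0) :
    ∑ l : Idx m, w l * (lam l * minimizer n m σ lam q l) = 0 := by
  rw [averageG_transpose_mulVec_eq_zero_iff hσ] at hw
  -- Extension by zero turns sums over the subtype into sums over integers.
  set z : ℤ → ℝ := fun l => if hl : l ∈ modes m then w ⟨l, hl⟩ else 0
  have hz : ∀ l : Idx m, z l = w l := fun l => dif_pos l.2
  simp_rw [← hz] at hw ⊢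
  rw [Finset.sum_coe_sort (modes m) (fun l => z l * (lam l * minimizer n m σ lam q l))]
  refine sum_mul_minimizer_eq_zero hlam q z fun k hk => ?_
  rw [← sum_idx_ite_fold n m (fun l => weight n σ l * z l)]
  exact hw ⟨k, hk⟩

theorem kgA_mulVec (m : ℕ) (x y : Idx m → ℝ) : (kgA m).mulVec (Sum.elim x y)
    = Sum.elim (fun l : Idx m => lamU l * x l) y := by
  rw [kgA, Matrix.fromBlocks_mulVec]
  funext i
  rcases i with i | i
  · simp [lambdaSq, Matrix.mulVec_diagonal, lamU]
  · simp

theorem exactMean_kg (hσ : σ ≠ 0) (h : n ≤ m) (ω : Coeffs) (t : ℝ) :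
    exactMean (kgL m) (kgA m) (kgG n m σ) (truncate m ω) t = flow m t (meanCoeff n m σ ω) := by
  have hG : ∀ x y : Idx m → ℝ, (kgG n m σ).transpose.mulVec (Sum.elim x y)
      = Sum.elim ((averageG n m σ).transpose.mulVec x) ((averageG n m σ).transpose.mulVec y) := by
    intro x y
    simp [kgG, Matrix.fromBlocks_transpose, Matrix.fromBlocks_mulVec]
  refine exactMean_eq _ _ _ _ _ _ ?_ ?_ ?_ ?_
  · simp [Matrix.IsSymm, kgA, lambdaSq, Matrix.fromBlocks_transpose]
  · intro x
    rw [← Sum.elim_comp_inl_inr x, kgA_mulVec]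
    simp only [dotProduct, Fintype.sum_sum_type, Sum.elim_inl, Sum.elim_inr]
    refine add_le_add (Finset.sum_le_sum fun l _ => ?_) le_rfl
    unfold lamU
    simp only [Function.comp]
    nlinarith [mul_self_nonneg (x (Sum.inl l)), mul_self_nonneg (((l : ℤ) : ℝ) * x (Sum.inl l))]
  · have hsub : (meanCoeff n m σ ω - truncate m ω).ofLp = Sum.elim
        (fun l : Idx m => minimizer n m σ lamU (fun k => ω (Sum.inl k)) l - ω (Sum.inl l))
        (fun l : Idx m => minimizer n m σ (fun _ => 1) (fun k => ω (Sum.inr k)) l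
          - ω (Sum.inr l)) := by
      funext i
      rcases i with i | i <;> rfl
    rw [hsub, hG, averageG_transpose_mulVec_minimizer_sub hσ lamU_pos h (fun k => ω (Sum.inl k)),
      averageG_transpose_mulVec_minimizer_sub hσ (fun _ => one_pos) h (fun k => ω (Sum.inr k))]
    exact Sum.elim_const_const 0
  · intro w hw
    rw [← Sum.elim_comp_inl_inr w, hG] at hw
    have h1 : (averageG n m σ).transpose.mulVec (w ∘ Sum.inl) = 0 :=
      funext fun α => congrFun hw (Sum.inl α)
    have h2 : (averageG n m σ).transpose.mulVec (w ∘ Sum.inr) = 0 :=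
      funext fun α => congrFun hw (Sum.inr α)
    have e1 := sum_idx_mul_minimizer_eq_zero hσ lamU_pos (fun k => ω (Sum.inl k)) h1
    have e2 := sum_idx_mul_minimizer_eq_zero (lam := fun _ => 1) hσ (fun _ => one_pos)
      (fun k => ω (Sum.inr k)) h2
    simp only [one_mul] at e2
    rw [meanCoeff, kgA_mulVec]
    simp only [dotProduct, Fintype.sum_sum_type, Sum.elim_inl, Sum.elim_inr]
    simp only [Function.comp] at e1 e2
    rw [e1, e2, add_zero]

/-- The squared energy distance of two exact means. -/
def meanDist (n m m' : ℕ) (σ : ℝ) (lam q : ℤ → ℝ) : ℝ :=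
  ∑ k ∈ modes n, (classSum n m σ q k ^ 2 / classNormSq n m σ lam k
    + classSum n m' σ q k ^ 2 / classNormSq n m' σ lam k
    - 2 * (classSum n m σ q k * classSum n m' σ q k) / classNormSq n m' σ lam k)

theorem sum_ite_mul_idx (m : ℕ) (f : ℤ → ℝ) (k : ℤ) :
    ∑ l : Idx m, (if k = (l : ℤ) then 1 else 0) * f l = if k ∈ modes m then f k else 0 := by
  rw [Finset.sum_coe_sort (modes m) (fun l => (if k = l then 1 else 0) * f l)]
  simp

theorem norm_field_meanCoeff_sub_sq {m' : ℕ} (h : n ≤ m) (h' : m ≤ m') (ω : Coeffs) :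
    ‖field m (meanCoeff n m σ ω) - field m' (meanCoeff n m' σ ω)‖ ^ 2
      = meanDist n m m' σ lamU (fun k => ω (Sum.inl k))
        + meanDist n m m' σ (fun _ => 1) (fun k => ω (Sum.inr k)) := by
  rw [meanDist, meanDist, ← sum_mul_minimizer_sub_sq lamU_pos h h',
    ← sum_mul_minimizer_sub_sq (fun _ => one_pos) h h', ← field_extend h', ← field_sub,
    norm_field_sq]
  simp only [PiLp.sub_apply, extend_inl, extend_inr, meanCoeff, Sum.elim_inl, Sum.elim_inr]
  rw [← Finset.sum_coe_sort (modes m'), ← Finset.sum_coe_sort (modes m')]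
  simp only [sum_ite_mul_idx m (minimizer n m σ lamU fun k => ω (Sum.inl k)),
    sum_ite_mul_idx m (minimizer n m σ (fun _ => 1) fun k => ω (Sum.inr k)), lamU, one_mul]


/-! ### The decay of the aliased modes -/

/-- The squared decay factor of the averaging kernel at scale `2n+1`. -/
def decay (n : ℕ) (σ : ℝ) : ℝ := Real.exp (-((2 * n + 1) * σ ^ 2 / 2))

/-- The order in `decay` of the first mode outside the trial space `r`. -/
def aliasOrder (n r : ℕ) : ℕ := (r + 1) * ((2 * n + 1) * r + 1)

theorem decay_pos (n : ℕ) (σ : ℝ) : 0 < decay n σ := Real.exp_pos _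

/-- Write `ρ` for the signed residue and factor `l² - ρ² = (|l| - ρ)(|l| + ρ)`. The first factor is
a multiple of `2n+1`, at least the `(r+1)`-th because `l` lies outside the trial space; the second
is at least `|l| - n`. The product of the two bounds even exceeds the claim when `r` and `d` are
positive. -/
theorem aliasOrder_mul_le_sq_sub_sq (n r d : ℕ) {l : ℤ}
    (hl : |l| = (n + r * (2 * n + 1) : ℕ) + 1 + (d : ℤ)) :
    (2 * n + 1) * ((aliasOrder n r : ℤ) + d) ≤ l ^ 2 - fold n l ^ 2 := by
  obtain ⟨j, hj⟩ := exists_abs_eq n l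
  obtain ⟨h1, h2⟩ := abs_le.1 (abs_residue_le n l)
  have e1 : l ^ 2 = |l| ^ 2 := (sq_abs l).symm
  have e2 : fold n l ^ 2 = residue n l ^ 2 := by rw [← sq_abs, abs_fold, sq_abs]
  have hjr : (r : ℤ) + 1 ≤ j := by
    by_contra hlt
    have hlt' : j ≤ r := by omega
    have := mul_le_mul_of_nonneg_right hlt' (show (0 : ℤ) ≤ 2 * n + 1 by positivity)
    push_cast at hl
    linarith
  have hx : ((r : ℤ) + 1) * (2 * n + 1) ≤ |l| - residue n l := by
    rw [hj, add_sub_cancel_right]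
    exact mul_le_mul_of_nonneg_right hjr (by positivity)
  have hy : (r : ℤ) * (2 * n + 1) + 1 + d ≤ |l| + residue n l := by
    push_cast at hl
    linarith
  have hmul := mul_le_mul hx hy (by positivity) (le_trans (by positivity) hx)
  have e3 : l ^ 2 - fold n l ^ 2 = (|l| - residue n l) * (|l| + residue n l) := by
    rw [e1, e2]
    ring
  rw [e3]
  refine le_trans ?_ hmul
  unfold aliasOrder
  push_cast
  have : (0 : ℤ) ≤ r * (2 * n + 1) * d := by positivity
  nlinarith

theorem kernelCoeff_sq_div_le (n r d : ℕ) (σ : ℝ) {l : ℤ}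
    (hl : |l| = (n + r * (2 * n + 1) : ℕ) + 1 + (d : ℤ)) :
    kernelCoeff σ l ^ 2 / kernelCoeff σ (fold n l) ^ 2 ≤ decay n σ ^ (aliasOrder n r + d) := by
  unfold kernelCoeff decay
  rw [← Real.exp_nat_mul, ← Real.exp_nat_mul, ← Real.exp_nat_mul, ← Real.exp_sub, Real.exp_le_exp]
  have h : (2 * (n : ℝ) + 1) * ((aliasOrder n r : ℝ) + d) ≤ (l : ℝ) ^ 2 - (fold n l : ℝ) ^ 2 := by
    exact_mod_cast aliasOrder_mul_le_sq_sub_sq n r d hl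
  have h2 := mul_le_mul_of_nonneg_right h (show 0 ≤ σ ^ 2 / 2 by positivity)
  push_cast
  linarith

theorem sum_modes_sdiff (m p : ℕ) (f : ℤ → ℝ) :
    ∑ l ∈ modes (m + p) \ modes m, f l
      = ∑ d ∈ Finset.range p, (f (m + 1 + d : ℤ) + f (-(m + 1 + d : ℤ))) := by
  induction p with
  | zero => simp
  | succ p ih =>
    have h : modes (m + (p + 1)) \ modes m
        = insert (-((m : ℤ) + 1 + p)) (insert ((m : ℤ) + 1 + p) (modes (m + p) \ modes m)) := by
      ext x
      simp only [Finset.mem_Icc, Finset.mem_insert, Finset.mem_sdiff]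
      push_cast
      omega
    rw [h, Finset.sum_insert, Finset.sum_insert, ih, Finset.sum_range_succ]
    · ring
    · simp only [Finset.mem_Icc, Finset.mem_sdiff]
      omega
    · simp only [Finset.mem_Icc, Finset.mem_insert, Finset.mem_sdiff]
      omega

/-- The modes outside the trial space come in pairs `±(m + 1 + d)`, which doubles the factor 2, and
the order grows with `d`, which leaves a geometric series. The bound is uniform in `p`. -/
theorem sum_kernelCoeff_sq_div_le (n r p : ℕ) {σ : ℝ} (hσ : decay n σ < 1) :
    ∑ l ∈ modes (n + r * (2 * n + 1) + p) \ modes (n + r * (2 * n + 1)),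
        2 * (kernelCoeff σ l ^ 2 / kernelCoeff σ (fold n l) ^ 2)
      ≤ 4 * decay n σ ^ aliasOrder n r / (1 - decay n σ) := by
  rw [sum_modes_sdiff]
  have h : ∀ d : ℕ, |((n + r * (2 * n + 1) : ℕ) + 1 + d : ℤ)|
      = (n + r * (2 * n + 1) : ℕ) + 1 + (d : ℤ) := fun d => abs_of_nonneg (by positivity)
  calc _ ≤ ∑ d ∈ Finset.range p, 4 * decay n σ ^ aliasOrder n r * decay n σ ^ d := by
        refine Finset.sum_le_sum fun d _ => ?_
        have h1 := kernelCoeff_sq_div_le n r d σ (h d)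
        have h2 := kernelCoeff_sq_div_le n r d σ ((abs_neg _).trans (h d))
        rw [pow_add] at h1 h2
        linarith
    _ = 4 * decay n σ ^ aliasOrder n r * ∑ d ∈ Finset.range p, decay n σ ^ d := by
        rw [Finset.mul_sum]
    _ ≤ 4 * decay n σ ^ aliasOrder n r * (1 - decay n σ)⁻¹ := by
        refine mul_le_mul_of_nonneg_left ?_
          (mul_nonneg zero_le_four (pow_nonneg (decay_pos n σ).le _))
        rw [← tsum_geometric_of_lt_one (decay_pos n σ).le hσ]
        exact Summable.sum_le_tsum _ (fun d _ => pow_nonneg (decay_pos n σ).le d)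
          (summable_geometric_of_lt_one (decay_pos n σ).le hσ)

theorem abs_fold_le_abs (n : ℕ) (l : ℤ) : |fold n l| ≤ |l| := by
  by_cases h : l ∈ modes n
  · rw [fold_of_mem h]
  · have h1 := fold_mem n l
    rw [Finset.mem_Icc, ← abs_le] at h h1
    exact h1.trans (not_le.1 h).le

/-- The denominator is bounded below by the term of the representative `k` alone. Monotonicity of
`lam` then removes the variances, and the squared alias factor costs at most 2. -/
theorem sum_classNormSq_sub_div_le (n r p : ℕ) {σ : ℝ} (hσ : decay n σ < 1) {lam : ℤ → ℝ}
    (hlam : ∀ l, 0 < lam l) (hmono : ∀ k l, |k| ≤ |l| → lam k ≤ lam l) :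
    ∑ k ∈ modes n, (classNormSq n (n + r * (2 * n + 1) + p) σ lam k
        - classNormSq n (n + r * (2 * n + 1)) σ lam k)
          / classNormSq n (n + r * (2 * n + 1) + p) σ lam k
      ≤ 4 * decay n σ ^ aliasOrder n r / (1 - decay n σ) := by
  set m := n + r * (2 * n + 1) with hm
  have hnm : n ≤ m := Nat.le_add_right _ _
  refine le_trans ?_ (sum_kernelCoeff_sq_div_le n r p hσ)
  rw [← hm, ← Finset.sum_fiberwise_of_maps_to (s := modes (m + p) \ modes m) (t := modes n)
    (g := fold n) (fun l _ => fold_mem n l)]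
  refine Finset.sum_le_sum fun k hk => ?_
  have hsub : classNormSq n (m + p) σ lam k - classNormSq n m σ lam k
      = ∑ l ∈ modes (m + p) \ modes m with fold n l = k, weight n σ l ^ 2 / lam l := by
    rw [sub_eq_iff_eq_add, classNormSq, classNormSq,
      ← Finset.sum_sdiff (aliasClass_subset (Nat.le_add_right m p) k)]
    congr 1
    refine Finset.sum_congr ?_ fun _ _ => rfl
    ext l
    simp only [Finset.mem_sdiff, Finset.mem_filter, mem_aliasClass]
    tauto
  rw [hsub, Finset.sum_div]
  refine Finset.sum_le_sum fun l hl => ?_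
  have hfold := (Finset.mem_filter.1 hl).2
  have hg := pow_pos (kernelCoeff_pos σ k) 2
  have hle := kernelCoeff_sq_div_le_classNormSq (σ := σ) hlam (hnm.trans (Nat.le_add_right m p)) hk
  have hlk : lam k ≤ lam l := hmono _ _ (hfold ▸ abs_fold_le_abs n l)
  calc weight n σ l ^ 2 / lam l / classNormSq n (m + p) σ lam k
      ≤ weight n σ l ^ 2 / lam l / (kernelCoeff σ k ^ 2 / lam k) :=
        div_le_div_of_nonneg_left (div_nonneg (sq_nonneg _) (hlam l).le) (div_pos hg (hlam k)) hle
    _ = aliasCoeff n l ^ 2 * (lam k / lam l) * (kernelCoeff σ l ^ 2 / kernelCoeff σ k ^ 2) := by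
        have := (hlam l).ne'
        have := (hlam k).ne'
        rw [weight]
        field_simp
    _ ≤ 2 * 1 * (kernelCoeff σ l ^ 2 / kernelCoeff σ k ^ 2) := by
        refine mul_le_mul_of_nonneg_right ?_ (div_nonneg (sq_nonneg _) (sq_nonneg _))
        exact mul_le_mul (aliasCoeff_sq_le n l) ((div_le_one (hlam l)).2 hlk)
          (div_nonneg (hlam k).le (hlam l).le) zero_le_two
    _ = 2 * (kernelCoeff σ l ^ 2 / kernelCoeff σ (fold n l) ^ 2) := by rw [hfold, mul_one]

/-! ### Mean square distance of the exact means -/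

section Probability

variable {Ω : Type*} [MeasurableSpace Ω] {μ : Measure Ω}

/-- By orthogonality only the modes common to both classes contribute, so the covariance is the
squared norm of the smaller class. -/
theorem integral_classSum_mul {n m m' : ℕ} (h : m ≤ m') (σ : ℝ) {lam : ℤ → ℝ} {q : Ω → ℤ → ℝ}
    (hint : ∀ i j, Integrable (fun ω => q ω i * q ω j) μ)
    (hcov : ∀ i j, ∫ ω, q ω i * q ω j ∂μ = if i = j then (lam i)⁻¹ else 0) (k : ℤ) :
    Integrable (fun ω => classSum n m σ (q ω) k * classSum n m' σ (q ω) k) μ ∧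
      ∫ ω, classSum n m σ (q ω) k * classSum n m' σ (q ω) k ∂μ = classNormSq n m σ lam k := by
  have e : ∀ ω, classSum n m σ (q ω) k * classSum n m' σ (q ω) k
      = ∑ i ∈ aliasClass n m k, ∑ j ∈ aliasClass n m' k,
        weight n σ i * weight n σ j * (q ω i * q ω j) := by
    intro ω
    rw [classSum, classSum, Finset.sum_mul_sum]
    exact Finset.sum_congr rfl fun i _ => Finset.sum_congr rfl fun j _ => by ring
  simp_rw [e]
  constructor
  · exact integrable_finsetSum _ fun i _ => integrable_finsetSum _ fun j _ =>
      (hint i j).const_mul _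
  · rw [integral_finsetSum _ fun i _ => integrable_finsetSum _ fun j _ =>
      (hint i j).const_mul _, classNormSq]
    refine Finset.sum_congr rfl fun i hi => ?_
    rw [integral_finsetSum _ fun j _ => (hint i j).const_mul _]
    simp_rw [integral_const_mul, hcov]
    rw [Finset.sum_eq_single i]
    · rw [if_pos rfl]
      ring
    · intro j _ hj
      rw [if_neg hj.symm, mul_zero]
    · exact fun hn => absurd (aliasClass_subset h k hi) hn

theorem integral_meanDist {n m m' : ℕ} (hn : n ≤ m) (h : m ≤ m') (σ : ℝ) {lam : ℤ → ℝ}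
    (hlam : ∀ l, 0 < lam l) {q : Ω → ℤ → ℝ}
    (hint : ∀ i j, Integrable (fun ω => q ω i * q ω j) μ)
    (hcov : ∀ i j, ∫ ω, q ω i * q ω j ∂μ = if i = j then (lam i)⁻¹ else 0) :
    Integrable (fun ω => meanDist n m m' σ lam (q ω)) μ ∧
      ∫ ω, meanDist n m m' σ lam (q ω) ∂μ = 2 * ∑ k ∈ modes n,
        (classNormSq n m' σ lam k - classNormSq n m σ lam k) / classNormSq n m' σ lam k := by
  have h1 := fun k => integral_classSum_mul (n := n) (μ := μ) (le_refl m) σ hint hcov k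
  have h2 := fun k => integral_classSum_mul (n := n) (μ := μ) (le_refl m') σ hint hcov k
  have h3 := fun k => integral_classSum_mul (n := n) (μ := μ) h σ hint hcov k
  unfold meanDist
  simp only [sq]
  have i12 : ∀ k, Integrable (fun ω =>
      classSum n m σ (q ω) k * classSum n m σ (q ω) k / classNormSq n m σ lam k
      + classSum n m' σ (q ω) k * classSum n m' σ (q ω) k / classNormSq n m' σ lam k) μ :=
    fun k => ((h1 k).1.div_const _).add ((h2 k).1.div_const _)
  have i3 := fun k => ((h3 k).1.const_mul 2).div_const (classNormSq n m' σ lam k)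
  have i123 : ∀ k, Integrable (fun ω =>
      classSum n m σ (q ω) k * classSum n m σ (q ω) k / classNormSq n m σ lam k
      + classSum n m' σ (q ω) k * classSum n m' σ (q ω) k / classNormSq n m' σ lam k
      - 2 * (classSum n m σ (q ω) k * classSum n m' σ (q ω) k) / classNormSq n m' σ lam k) μ :=
    fun k => (i12 k).sub (i3 k)
  constructor
  · exact integrable_finsetSum _ fun k _ => i123 k
  · rw [integral_finsetSum _ fun k _ => i123 k, Finset.mul_sum]
    refine Finset.sum_congr rfl fun k hk => ?_
    rw [integral_sub (i12 k) (i3 k), integral_add ((h1 k).1.div_const _) ((h2 k).1.div_const _),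
      integral_div, integral_div, integral_div, integral_const_mul, (h1 k).2, (h2 k).2, (h3 k).2]
    have n1 := (classNormSq_pos (σ := σ) hlam hn hk).ne'
    have n2 := (classNormSq_pos (σ := σ) hlam (hn.trans h) hk).ne'
    field_simp
    ring

end Probability

instance : IsProbabilityMeasure coeffMeasure := by unfold coeffMeasure; infer_instance

/-- The second moments are written as inverses of the inverse variances, the form of `hcov` above.
-/
theorem integral_coeff_mul (i j : ℤ ⊕ ℤ) :
    Integrable (fun ω : Coeffs => ω i * ω j) coeffMeasure ∧
      ∫ ω, ω i * ω j ∂coeffMeasure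
        = if i = j then Sum.elim (fun k => (lamU k)⁻¹) (fun _ => (1 : ℝ)⁻¹) i else 0 := by
  set v : ℤ ⊕ ℤ → NNReal :=
    fun i => Sum.elim (fun k : ℤ => Real.toNNReal (1 / ((k : ℝ) ^ 2 + 1))) (fun _ => 1) i with hv
  have hmp : ∀ i, MeasurePreserving (Function.eval i) coeffMeasure (gaussianReal 0 (v i)) :=
    fun i => measurePreserving_eval_infinitePi (fun i => gaussianReal 0 (v i)) i
  have hmem : ∀ i, MemLp (fun ω : Coeffs => ω i) 2 coeffMeasure := fun i =>
    (memLp_id_gaussianReal (μ := 0) (v := v i) 2).comp_measurePreserving (hmp i)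
  refine ⟨(hmem i).integrable_mul (hmem j), ?_⟩
  split_ifs with hij
  · subst hij
    have h1 : ∫ ω, ω i * ω i ∂coeffMeasure = ∫ x, x * x ∂(gaussianReal 0 (v i)) := by
      rw [← (hmp i).map_eq, integral_map (hmp i).aemeasurable
        (Continuous.aestronglyMeasurable (by fun_prop))]
    have h2 := variance_eq_integral (X := id) (μ := gaussianReal 0 (v i)) aemeasurable_id
    rw [variance_id_gaussianReal] at h2
    simp only [id, integral_id_gaussianReal, sub_zero, sq] at h2
    rw [h1, ← h2]
    rcases i with k | k
    · simp only [hv, Sum.elim_inl, lamU, one_div]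
      exact Real.coe_toNNReal _ (by positivity)
    · simp [hv]
  · have hind : IndepFun (fun ω : Coeffs => ω i) (fun ω : Coeffs => ω j) coeffMeasure :=
      (iIndepFun_infinitePi (P := fun i => gaussianReal 0 (v i)) (X := fun _ => id)
        (fun _ => measurable_id)).indepFun hij
    rw [hind.integral_fun_mul_eq_mul_integral (hmem i).1 (hmem j).1]
    have h1 : ∫ ω, ω i ∂coeffMeasure = ∫ x, x ∂(gaussianReal 0 (v i)) := by
      rw [← (hmp i).map_eq, integral_map (hmp i).aemeasurable
        (Continuous.aestronglyMeasurable (by fun_prop))]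
    rw [h1, integral_id_gaussianReal, zero_mul]

/-- The constant 16 is 4 from the sum over classes, times 2 from `integral_meanDist`, times 2 for
the components `u` and `π`. -/
theorem integral_norm_field_meanCoeff_sub_sq_le (n r p : ℕ) {σ : ℝ} (hσ : decay n σ < 1) :
    Integrable (fun ω => ‖field (n + r * (2 * n + 1)) (meanCoeff n (n + r * (2 * n + 1)) σ ω)
        - field (n + r * (2 * n + 1) + p) (meanCoeff n (n + r * (2 * n + 1) + p) σ ω)‖ ^ 2)
        coeffMeasure ∧
      ∫ ω, ‖field (n + r * (2 * n + 1)) (meanCoeff n (n + r * (2 * n + 1)) σ ω)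
        - field (n + r * (2 * n + 1) + p) (meanCoeff n (n + r * (2 * n + 1) + p) σ ω)‖ ^ 2
        ∂coeffMeasure ≤ 16 * decay n σ ^ aliasOrder n r / (1 - decay n σ) := by
  have hU := sum_classNormSq_sub_div_le n r p hσ lamU_pos (fun k l h => by
    have : (k : ℝ) ^ 2 ≤ (l : ℝ) ^ 2 := sq_le_sq.2 (by exact_mod_cast h)
    unfold lamU
    linarith)
  have hP := sum_classNormSq_sub_div_le n r p hσ (lam := fun _ => 1) (fun _ => one_pos)
    (fun _ _ _ => le_rfl)
  set m := n + r * (2 * n + 1) with hm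
  have hnm : n ≤ m := Nat.le_add_right _ _
  have hU' := integral_meanDist (μ := coeffMeasure) hnm (Nat.le_add_right m p) σ lamU_pos
    (q := fun ω k => ω (Sum.inl k))
    (fun i j => (integral_coeff_mul _ _).1) (fun i j => by rw [(integral_coeff_mul _ _).2]; simp)
  have hP' := integral_meanDist (μ := coeffMeasure) hnm (Nat.le_add_right m p) σ
    (lam := fun _ => 1) (fun _ => one_pos) (q := fun ω k => ω (Sum.inr k))
    (fun i j => (integral_coeff_mul _ _).1) (fun i j => by rw [(integral_coeff_mul _ _).2]; simp)
  simp_rw [norm_field_meanCoeff_sub_sq hnm (Nat.le_add_right m p)]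
  refine ⟨hU'.1.add hP'.1, ?_⟩
  rw [integral_add hU'.1 hP'.1, hU'.2, hP'.2]
  refine le_trans (add_le_add (mul_le_mul_of_nonneg_left hU zero_le_two)
    (mul_le_mul_of_nonneg_left hP zero_le_two)) (le_of_eq ?_)
  ring


/-! ### Completeness of the energy space -/

theorem inner_toH0_right (u : H0) {f : ℝ → ℝ} (hf : Continuous f) :
    inner ℝ u (toH0 f hf) = ∫ x, u x * f x ∂periodMeasure := by
  rw [L2.inner_def]
  refine integral_congr_ae ?_
  filter_upwards [(memLp_of_continuous hf).coeFn_toLp] with x hx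
  rw [toH0, hx]
  simp [mul_comm]

-- Each test function imposes a closed condition, since pairing with a fixed element of `H0` is
-- continuous. This gives the completeness needed for limits in the energy space.
open scoped ContDiff in
theorem isClosed_H1 : IsClosed (H1 : Set (WithLp 2 (H0 × H0))) := by
  have h : (H1 : Set (WithLp 2 (H0 × H0))) = ⋂ (φ : ℝ → ℝ) (hφ : ContDiff ℝ ∞ φ)
      (_ : Function.Periodic φ (2 * Real.pi)),
      {z | inner ℝ z.fst (toH0 (deriv φ) (hφ.continuous_deriv (by simp)))
        = -inner ℝ z.snd (toH0 φ hφ.continuous)} := by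
    ext z
    simp only [Set.mem_iInter, Set.mem_ofPred_eq, inner_toH0_right]
    rfl
  rw [h]
  refine isClosed_iInter fun φ => isClosed_iInter fun hφ => isClosed_iInter fun _ => ?_
  have h1 : Continuous fun z : WithLp 2 (H0 × H0) => z.fst := WithLp.continuous_fst ..
  have h2 : Continuous fun z : WithLp 2 (H0 × H0) => z.snd := WithLp.continuous_snd ..
  exact isClosed_eq (h1.inner continuous_const) (h2.inner continuous_const).neg

instance : CompleteSpace H1 := isClosed_H1.completeSpace_coe

instance : CompleteSpace EnergySpace := inferInstanceAs (CompleteSpace (WithLp 2 (H1 × H0)))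

/-! ### Convergence of the exact means -/

theorem exactSolution_eq {n : ℕ} {σ : ℝ} (hσ : σ ≠ 0) (r : ℕ) (ω : Coeffs) (t : ℝ) :
    exactSolution n σ r ω t = field (n + r * (2 * n + 1))
      (flow (n + r * (2 * n + 1)) t (meanCoeff n (n + r * (2 * n + 1)) σ ω)) := by
  rw [exactSolution, exactMean_kg hσ (Nat.le_add_right _ _)]

theorem flow_zero (m : ℕ) (c : EuclideanSpace ℝ (Idx m ⊕ Idx m)) : flow m 0 c = c := by
  rw [flow, zero_smul, NormedSpace.exp_zero]
  simp

theorem norm_exactSolution_sub {n : ℕ} {σ : ℝ} (hσ : σ ≠ 0) (r s : ℕ) (ω : Coeffs) (t : ℝ) :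
    ‖exactSolution n σ r ω t - exactSolution n σ s ω t‖
      = ‖exactSolution n σ r ω 0 - exactSolution n σ s ω 0‖ := by
  have key : ∀ r s : ℕ, r ≤ s → ‖exactSolution n σ r ω t - exactSolution n σ s ω t‖
      = ‖exactSolution n σ r ω 0 - exactSolution n σ s ω 0‖ := by
    intro r s hrs
    have h : n + r * (2 * n + 1) ≤ n + s * (2 * n + 1) := by gcongr
    -- Both sides reduce to the distance of the initial means.
    simp only [exactSolution_eq hσ, norm_field_flow_sub h]
  rcases le_total r s with h | h
  · exact key r s h
  · rw [norm_sub_rev, key s r h, norm_sub_rev]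

theorem aestronglyMeasurable_exactSolution_zero {n : ℕ} {σ : ℝ} (hσ : σ ≠ 0) (r : ℕ) :
    AEStronglyMeasurable (fun ω => exactSolution n σ r ω 0) coeffMeasure := by
  simp only [exactSolution_eq hσ, flow_zero]
  set m := n + r * (2 * n + 1)
  have h1 : Continuous (field m) := by
    unfold field
    fun_prop
  have h2 : Measurable (meanCoeff n m σ) := by
    refine (WithLp.measurable_toLp 2 _).comp (measurable_pi_iff.2 fun i => ?_)
    rcases i with i | i
    · simp only [Sum.elim_inl, minimizer, classSum]
      fun_prop
    · simp only [Sum.elim_inr, minimizer, classSum]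
      fun_prop
  exact h1.comp_aestronglyMeasurable h2.aestronglyMeasurable

theorem integral_norm_exactSolution_sub_sq_le {n r s : ℕ} (h : r ≤ s) {σ : ℝ} (hσ : σ ≠ 0)
    (hd : decay n σ < 1) :
    Integrable (fun ω => ‖exactSolution n σ r ω 0 - exactSolution n σ s ω 0‖ ^ 2) coeffMeasure ∧
      ∫ ω, ‖exactSolution n σ r ω 0 - exactSolution n σ s ω 0‖ ^ 2 ∂coeffMeasure
        ≤ 16 * decay n σ ^ aliasOrder n r / (1 - decay n σ) := by
  simp only [exactSolution_eq hσ, flow_zero]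
  obtain ⟨p, rfl⟩ := Nat.exists_eq_add_of_le h
  have h1 := integral_norm_field_meanCoeff_sub_sq_le n r (p * (2 * n + 1)) hd
  rwa [show n + r * (2 * n + 1) + p * (2 * n + 1) = n + (r + p) * (2 * n + 1) by ring] at h1

/-- A bound for the mean square error of the exact means. -/
def errorBound (n : ℕ) (σ : ℝ) (r : ℕ) : ℝ := 16 * decay n σ ^ aliasOrder n r / (1 - decay n σ)

theorem errorBound_nonneg {n : ℕ} {σ : ℝ} (hd : decay n σ < 1) (r : ℕ) : 0 ≤ errorBound n σ r :=
  div_nonneg (mul_nonneg (by norm_num) (pow_nonneg (decay_pos n σ).le _)) (sub_pos.2 hd).le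

theorem eLpNorm_exactSolution_sub_le {n r s : ℕ} (h : r ≤ s) {σ : ℝ} (hσ : σ ≠ 0)
    (hd : decay n σ < 1) :
    eLpNorm (fun ω => exactSolution n σ r ω 0 - exactSolution n σ s ω 0) 2 coeffMeasure
      ≤ ENNReal.ofReal (√(errorBound n σ r)) := by
  obtain ⟨hint, hle⟩ := integral_norm_exactSolution_sub_sq_le h hσ hd
  have hmem : MemLp (fun ω => exactSolution n σ r ω 0 - exactSolution n σ s ω 0) 2 coeffMeasure :=
    (memLp_two_iff_integrable_sq_norm ((aestronglyMeasurable_exactSolution_zero hσ r).sub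
      (aestronglyMeasurable_exactSolution_zero hσ s))).2 hint
  rw [hmem.eLpNorm_eq_integral_rpow_norm two_ne_zero ENNReal.ofNat_ne_top]
  refine ENNReal.ofReal_le_ofReal ?_
  rw [Real.sqrt_eq_rpow]
  simp only [ENNReal.toReal_ofNat, Real.rpow_two, one_div]
  exact Real.rpow_le_rpow (integral_nonneg fun _ => sq_nonneg _) hle (by norm_num)

/-- For `δ ≤ 1/27` the prefactor `16 / (1 - δ)` is below 17, and `aliasOrder n r ≥ r + 1`. -/
theorem errorBound_le_geometric {n : ℕ} {σ : ℝ} (hd : decay n σ ≤ 1 / 27) (r : ℕ) :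
    errorBound n σ r ≤ 17 * decay n σ ^ (r + 1) := by
  have h0 := decay_pos n σ
  have h1 : decay n σ ^ aliasOrder n r ≤ decay n σ ^ (r + 1) :=
    pow_le_pow_of_le_one h0.le (by linarith) (Nat.le_mul_of_pos_right _ (Nat.succ_pos _))
  rw [errorBound, div_le_iff₀ (by linarith)]
  have h2 := pow_pos h0 (r + 1)
  nlinarith

/-- Convergence in mean square implies almost sure convergence at time `0`. -/
theorem ae_exists_tendsto_exactSolution_zero {n : ℕ} {σ : ℝ} (hσ : σ ≠ 0)
    (hd : decay n σ ≤ 1 / 27) : ∀ᵐ ω ∂coeffMeasure, ∃ l : EnergySpace,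
      Filter.Tendsto (fun r => exactSolution n σ r ω 0) Filter.atTop (nhds l) := by
  have hd1 : decay n σ < 1 := by linarith
  have h0 := decay_pos n σ
  -- Any summable majorant of the L² distances suffices; this one works because `17/27 < 4` and
  -- `1/27 ≤ (1/2)²`.
  set B : ℕ → ℝ := fun r => 2 * (1 / 2) ^ r with hB
  have hsum : Summable B := (summable_geometric_of_lt_one (by norm_num) (by norm_num)).mul_left 2
  have hBlt : ∀ r, √(errorBound n σ r) < B r := by
    intro r
    rw [Real.sqrt_lt' (by positivity)]
    refine (errorBound_le_geometric hd r).trans_lt ?_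
    have h1 : decay n σ ^ (r + 1) ≤ (1 / 27) * ((1 / 2) ^ r) ^ 2 := by
      rw [← pow_mul, mul_comm r 2, pow_mul, pow_succ, mul_comm]
      refine mul_le_mul hd (pow_le_pow_left₀ h0.le (by linarith) _) (by positivity) (by norm_num)
    have h2 : (0 : ℝ) < ((1 / 2) ^ r) ^ 2 := by positivity
    simp only [hB, mul_pow]
    linarith
  have key : ∀ N r s : ℕ, N ≤ r → r ≤ s →
      eLpNorm (fun ω => exactSolution n σ r ω 0 - exactSolution n σ s ω 0) 2 coeffMeasure
        < ENNReal.ofReal (B N) := by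
    intro N r s hN hrs
    refine (eLpNorm_exactSolution_sub_le hrs hσ hd1).trans_lt ?_
    rw [ENNReal.ofReal_lt_ofReal_iff (by positivity)]
    refine (hBlt r).trans_le ?_
    exact mul_le_mul_of_nonneg_left (pow_le_pow_of_le_one (by norm_num) (by norm_num) hN)
      zero_le_two
  refine Lp.ae_tendsto_of_cauchy_eLpNorm (p := 2) (B := fun r => ENNReal.ofReal (B r))
    (fun r => aestronglyMeasurable_exactSolution_zero hσ r) (by norm_num) ?_ ?_
  · exact hsum.tsum_ofReal_ne_top
  · intro N r s hr hs
    rcases le_total r s with h | h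
    · exact key N r s hr h
    · rw [eLpNorm_sub_comm]
      exact key N s r hs h

/-- The limit of the exact means. -/
def limitSolution (n : ℕ) (σ : ℝ) (ω : Coeffs) (t : ℝ) : EnergySpace :=
  Filter.limUnder Filter.atTop fun r => exactSolution n σ r ω t

/-- Distances of exact means are constant in time, so the Cauchy property at time 0 holds at every
`t`. One exceptional null set serves all times; on it `limUnder` may take an arbitrary value. -/
theorem tendsto_limitSolution {n : ℕ} {σ : ℝ} (hσ : σ ≠ 0) {ω : Coeffs}
    (h : ∃ l : EnergySpace,
      Filter.Tendsto (fun r => exactSolution n σ r ω 0) Filter.atTop (nhds l)) (t : ℝ) :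
    Filter.Tendsto (fun r => exactSolution n σ r ω t) Filter.atTop
      (nhds (limitSolution n σ ω t)) := by
  obtain ⟨l, hl⟩ := h
  refine CauchySeq.tendsto_limUnder ?_
  have hc := Metric.cauchySeq_iff.1 hl.cauchySeq
  refine Metric.cauchySeq_iff.2 fun ε hε => ?_
  obtain ⟨N, hN⟩ := hc ε hε
  refine ⟨N, fun r hr s hs => ?_⟩
  have := hN r hr s hs
  rw [dist_eq_norm] at this ⊢
  rwa [norm_exactSolution_sub hσ]

theorem norm_exactSolution_sub_limitSolution {n : ℕ} {σ : ℝ} (hσ : σ ≠ 0) {ω : Coeffs}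
    (h : ∃ l : EnergySpace,
      Filter.Tendsto (fun r => exactSolution n σ r ω 0) Filter.atTop (nhds l)) (r : ℕ) (t : ℝ) :
    ‖exactSolution n σ r ω t - limitSolution n σ ω t‖
      = ‖exactSolution n σ r ω 0 - limitSolution n σ ω 0‖ := by
  have h1 := ((tendsto_limitSolution hσ h t).const_sub (exactSolution n σ r ω t)).norm
  have h2 := ((tendsto_limitSolution hσ h 0).const_sub (exactSolution n σ r ω 0)).norm
  simp only [norm_exactSolution_sub hσ r _ ω t] at h1
  exact tendsto_nhds_unique h1 h2

/-- Fatou's lemma, applied to a bound that does not depend on the larger index. -/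
theorem eLpNorm_exactSolution_sub_limitSolution_le {n : ℕ} {σ : ℝ} (hσ : σ ≠ 0)
    (hd : decay n σ ≤ 1 / 27) (r : ℕ) :
    eLpNorm (fun ω => exactSolution n σ r ω 0 - limitSolution n σ ω 0) 2 coeffMeasure
      ≤ ENNReal.ofReal (√(errorBound n σ r)) := by
  have hd1 : decay n σ < 1 := by linarith
  refine (Lp.eLpNorm_lim_le_liminf_eLpNorm
    (f := fun s ω => exactSolution n σ r ω 0 - exactSolution n σ s ω 0)
    (fun s => (aestronglyMeasurable_exactSolution_zero hσ r).sub
      (aestronglyMeasurable_exactSolution_zero hσ s)) _ ?_).trans ?_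
  · filter_upwards [ae_exists_tendsto_exactSolution_zero hσ hd] with ω hω
    exact (tendsto_limitSolution hσ hω 0).const_sub _
  · refine Filter.liminf_le_of_frequently_le' (Filter.Eventually.frequently ?_)
    filter_upwards [Filter.eventually_ge_atTop r] with s hs
    exact eLpNorm_exactSolution_sub_le hs hσ hd1

/-- Chebyshev's inequality for the second moment: of the three powers of `ε`, two pay for the
threshold and one remains as the probability. -/
theorem measure_le_norm_exactSolution_sub_limitSolution {n : ℕ} {σ : ℝ} (hσ : σ ≠ 0)
    (hd : decay n σ ≤ 1 / 27) (r : ℕ) {ε : ℝ} (hε : 0 < ε) (hb : errorBound n σ r < ε ^ 3) :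
    coeffMeasure {ω | ε ≤ ‖exactSolution n σ r ω 0 - limitSolution n σ ω 0‖}
      < ENNReal.ofReal ε := by
  have hd1 : decay n σ < 1 := by linarith
  have hmeas : AEStronglyMeasurable
      (fun ω => exactSolution n σ r ω 0 - limitSolution n σ ω 0) coeffMeasure := by
    refine aestronglyMeasurable_of_tendsto_ae Filter.atTop
      (f := fun s ω => exactSolution n σ r ω 0 - exactSolution n σ s ω 0)
      (fun s => (aestronglyMeasurable_exactSolution_zero hσ r).sub
        (aestronglyMeasurable_exactSolution_zero hσ s)) ?_
    filter_upwards [ae_exists_tendsto_exactSolution_zero hσ hd] with ω hω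
    exact (tendsto_limitSolution hσ hω 0).const_sub _
  have h1 := mul_meas_ge_le_pow_eLpNorm' coeffMeasure two_ne_zero ENNReal.ofNat_ne_top hmeas
    (ENNReal.ofReal ε)
  have hset : {ω | ENNReal.ofReal ε ≤ ‖exactSolution n σ r ω 0 - limitSolution n σ ω 0‖ₑ}
      = {ω | ε ≤ ‖exactSolution n σ r ω 0 - limitSolution n σ ω 0‖} := by
    ext ω
    simp only [Set.mem_ofPred_eq]
    rw [← ofReal_norm, ENNReal.ofReal_le_ofReal_iff (norm_nonneg _)]
  rw [hset, ENNReal.toReal_ofNat, ENNReal.rpow_two, ENNReal.rpow_two,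
    ← ENNReal.ofReal_pow hε.le] at h1
  have h2 : eLpNorm (fun ω => exactSolution n σ r ω 0 - limitSolution n σ ω 0) 2 coeffMeasure ^ 2
      ≤ ENNReal.ofReal (errorBound n σ r) := by
    refine (pow_le_pow_left' (eLpNorm_exactSolution_sub_limitSolution_le hσ hd r) 2).trans ?_
    rw [← ENNReal.ofReal_pow (Real.sqrt_nonneg _), Real.sq_sqrt (errorBound_nonneg hd1 r)]
  have h3 : ENNReal.ofReal (errorBound n σ r) < ENNReal.ofReal (ε ^ 2) * ENNReal.ofReal ε := by
    rw [← ENNReal.ofReal_mul (by positivity), ENNReal.ofReal_lt_ofReal_iff (by positivity)]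
    calc _ < ε ^ 3 := hb
      _ = ε ^ 2 * ε := by ring
  exact lt_of_mul_lt_mul_left' ((h1.trans h2).trans_lt h3)

/-! ### The parameters -/

/-- The 6 in the hypothesis, halved in the exponent of `decay`, provides the three powers of
`(2n+1)^(-(ν+1))` needed for `ε_r³`. -/
theorem decay_le {n : ℕ} {σ ν : ℝ}
    (h : 6 * (ν + 1) * Real.log (2 * (n : ℝ) + 1) ≤ (2 * (n : ℝ) + 1) * σ ^ 2) :
    decay n σ ≤ (2 * (n : ℝ) + 1) ^ (-(3 * (ν + 1))) := by
  rw [decay, Real.rpow_def_of_pos (by positivity), Real.exp_le_exp]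
  linarith

theorem decay_le_one_div {n : ℕ} (hn : 1 ≤ n) {σ ν : ℝ} (hν : 0 ≤ ν)
    (h : 6 * (ν + 1) * Real.log (2 * (n : ℝ) + 1) ≤ (2 * (n : ℝ) + 1) * σ ^ 2) :
    decay n σ ≤ 1 / 27 := by
  have hn' : (1 : ℝ) ≤ n := by exact_mod_cast hn
  refine (decay_le h).trans ?_
  calc (2 * (n : ℝ) + 1) ^ (-(3 * (ν + 1))) ≤ (2 * (n : ℝ) + 1) ^ (-3 : ℝ) :=
        Real.rpow_le_rpow_of_exponent_le (by linarith) (by linarith)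
    _ ≤ (3 : ℝ) ^ (-3 : ℝ) :=
        Real.rpow_le_rpow_of_nonpos (by norm_num) (by linarith) (by norm_num)
    _ = 1 / 27 := by
        rw [Real.rpow_neg (by norm_num)]
        norm_num

theorem ne_zero_of_log_le {n : ℕ} (hn : 1 ≤ n) {σ ν : ℝ} (hν : 0 ≤ ν)
    (h : 6 * (ν + 1) * Real.log (2 * (n : ℝ) + 1) ≤ (2 * (n : ℝ) + 1) * σ ^ 2) : σ ≠ 0 := by
  have hn' : (1 : ℝ) ≤ n := by exact_mod_cast hn
  have hlog : 0 < Real.log (2 * (n : ℝ) + 1) := Real.log_pos (by linarith)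
  rintro rfl
  have : 0 < 6 * (ν + 1) * Real.log (2 * (n : ℝ) + 1) := by positivity
  linarith

theorem epsilon_pos (n : ℕ) (ν : ℝ) (r : ℕ) : 0 < epsilon n ν r := by
  unfold epsilon
  positivity

theorem errorBound_lt_epsilon_pow {n : ℕ} (hn : 1 ≤ n) {σ ν : ℝ} (hν : 0 ≤ ν)
    (h : 6 * (ν + 1) * Real.log (2 * (n : ℝ) + 1) ≤ (2 * (n : ℝ) + 1) * σ ^ 2) (r : ℕ) :
    errorBound n σ r < epsilon n ν r ^ 3 := by
  have h0 := decay_pos n σ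
  have hd := decay_le_one_div hn hν h
  have hn' : (1 : ℝ) ≤ n := by exact_mod_cast hn
  set b : ℝ := 2 * (n : ℝ) + 1
  have hb : 1 ≤ b := by simp only [b]; linarith
  have hb0 : 0 < b := by linarith
  set x : ℝ := b ^ (-((ν + 1) * (1 + (r : ℝ) + (r : ℝ) ^ 2 * b)))
  have hx : 0 < x := Real.rpow_pos_of_pos hb0 _
  have h1 : decay n σ ^ aliasOrder n r ≤ x ^ 3 := by
    calc decay n σ ^ aliasOrder n r ≤ (b ^ (-(3 * (ν + 1)))) ^ aliasOrder n r :=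
          pow_le_pow_left₀ h0.le (decay_le h) _
      _ = b ^ (-(3 * (ν + 1)) * (aliasOrder n r : ℝ)) := by
          rw [← Real.rpow_natCast, ← Real.rpow_mul hb0.le]
      _ ≤ b ^ (-((ν + 1) * (1 + (r : ℝ) + (r : ℝ) ^ 2 * b)) * (3 : ℕ)) := by
          refine Real.rpow_le_rpow_of_exponent_le hb ?_
          -- The order exceeds the exponent in `ε_r` by `r (2n+1)`, a surplus that is discarded.
          have e : (aliasOrder n r : ℝ) = 1 + (r : ℝ) + (r : ℝ) ^ 2 * b + r * b := by
            simp only [aliasOrder, b]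
            push_cast
            ring
          rw [e]
          have : 0 ≤ (ν + 1) * (r * b) := by positivity
          push_cast
          linarith
      _ = x ^ 3 := by rw [Real.rpow_mul hb0.le, Real.rpow_natCast]
  have h2 : epsilon n ν r ^ 3 = 64 * x ^ 3 := by
    rw [epsilon, mul_pow]
    norm_num
    rfl
  -- What remains is `16 < 64 (1 - δ)`, which holds since `δ ≤ 1/27`.
  rw [h2, errorBound, div_lt_iff₀ (by linarith)]
  have := pow_pos hx 3
  nlinarith

end OptimalPrediction

end

theorem theorem2 (n : ℕ) (hn : 1 ≤ n) (σ ν : ℝ) (hν : 0 ≤ ν)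
    (hσ : 6 * (ν + 1) * Real.log (2 * (n : ℝ) + 1) ≤ (2 * (n : ℝ) + 1) * σ ^ 2) :
    ∃ ψ : OptimalPrediction.Coeffs → ℝ → OptimalPrediction.EnergySpace,
      (∀ᵐ ω ∂OptimalPrediction.coeffMeasure, ∀ t : ℝ,
        Filter.Tendsto (fun r : ℕ => OptimalPrediction.exactSolution n σ r ω t)
          Filter.atTop (nhds (ψ ω t))) ∧
      ∀ r : ℕ, 1 - OptimalPrediction.epsilon n ν r <
        OptimalPrediction.coeffMeasure.real
          {ω | ∀ t : ℝ, ‖OptimalPrediction.exactSolution n σ r ω t - ψ ω t‖ <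
            OptimalPrediction.epsilon n ν r} := by
  open OptimalPrediction in
  open MeasureTheory in
  have hσ0 := ne_zero_of_log_le hn hν hσ
  have hd := decay_le_one_div hn hν hσ
  have hae := ae_exists_tendsto_exactSolution_zero hσ0 hd
  refine ⟨limitSolution n σ, ?_, fun r => ?_⟩
  · filter_upwards [hae] with ω hω t
    exact tendsto_limitSolution hσ0 hω t
  · set S := {ω | ∀ t : ℝ, ‖exactSolution n σ r ω t - limitSolution n σ ω t‖ < epsilon n ν r}
    have hε := epsilon_pos n ν r
    have hbad : coeffMeasure Sᶜ < ENNReal.ofReal (epsilon n ν r) := by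
      refine lt_of_le_of_lt (measure_mono_ae ?_)
        (measure_le_norm_exactSolution_sub_limitSolution hσ0 hd r hε
          (errorBound_lt_epsilon_pow hn hν hσ r))
      filter_upwards [hae] with ω hω hS
      by_contra hlt
      refine hS fun t => ?_
      rw [norm_exactSolution_sub_limitSolution hσ0 hω]
      exact not_le.1 hlt
    have hbad' : coeffMeasure.real Sᶜ < epsilon n ν r := by
      rwa [ENNReal.lt_ofReal_iff_toReal_lt (measure_ne_top _ _)] at hbad
    -- Subadditivity bounds the probability of `S` from below without requiring `S` to be
    -- measurable.
    have hunion := measureReal_union_le (μ := coeffMeasure) S Sᶜ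
    rw [Set.union_compl_self, probReal_univ] at hunion
    linarith
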